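/- Let $Y$ be a smooth $7$-manifold with a $G_2$ structure, i.e. a smooth $3$-form $\varphi$ which at every point is identified, by some linear isomorphism $T_yY\cong\mathbb R^7$, with the standard form $e^{123}+e^{145}+e^{167}+e^{246}-e^{257}-e^{347}-e^{356}$. Let $*$ be the Hodge star of the metric and orientation induced by $\varphi$, let $\psi=*\varphi$, and let $a\lrcorner\beta$ denote the contraction of a form $\beta$ with a $1$-form $a$, that is, insertion of the vector metrically dual to $a$ into the first slot of $\beta$. Let $\phi$ (the dilaton) and $f$ be smooth functions and $\widehat H$ a smooth $3$-form on $Y$. The heterotic $N=\tfrac12$ Killing spinor equations are $$d\varphi=2\,d\phi\wedge\varphi-*\widehat H-f\psi,\qquad d\psi=2\,d\phi\wedge\psi,\qquad *d\phi=-\tfrac12\widehat H\wedge\varphi,\qquad \tfrac12 *f=\widehat H\wedge\psi .$$ The torsion classes of the $G_2$ structure are the function $\tau_0$, the $1$-form $\tau_1$, the $2$-form $\tau_2$ and the $3$-form $\tau_3$ determined by $$d\varphi=\tau_0\psi+3\tau_1\wedge\varphi+*\tau_3,\qquad d\psi=4\tau_1\wedge\psi+*\tau_2,$$ where $\tau_2\wedge\psi=0$,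 $\varphi\wedge *\tau_3=0$ and $\tau_3\wedge\varphi=0$; the structure is integrable if $\tau_2=0$. (1) The Killing spinor equations hold if and only if $\widehat H=\tfrac1{14}f\varphi+H_\perp$ with $H_\perp\wedge\psi=0$ and $*H_\perp\wedge\varphi=0$, and the torsion classes are $$\tau_0=-\tfrac{15}{14}f,\qquad \tau_1=\tfrac12 d\phi,\qquad \tau_2=0,\qquad \tau_3=-H_\perp-\tfrac12 d\phi\lrcorner\psi,$$ where also $*\tau_3=-*H_\perp+\tfrac12 d\phi\wedge\varphi$. (2) If the Killing spinor equations and the Bianchi identities $d\widehat H=0$, $f=\text{constant}$ hold, then the flux equation of motion $d\left(*e^{-2\phi}\widehat H\right)=0$ holds. -/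

import Mathlib

open scoped Manifold ContDiff Nat

noncomputable section

namespace HetG2

/-! ### Multilinear algebra -/

section Algebra

set_option linter.unusedSectionVars false

variable {V : Type*} [AddCommGroup V] [Module ℝ V] [TopologicalSpace V]

theorem update_castAdd_left {k l : ℕ} [DecidableEq (Fin (k + l))] (v : Fin (k + l) → V)
    (a : Fin k) (x : V) :
    (fun i => Function.update v (Fin.castAdd l a) x (Fin.castAdd l i)) =
      Function.update (fun i => v (Fin.castAdd l i)) a x := by
  ext i
  by_cases h : i = a
  · subst h; simp
  · rw [Function.update_of_ne h, Function.update_of_ne (by simpa using h)]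

theorem update_castAdd_right {k l : ℕ} [DecidableEq (Fin (k + l))] (v : Fin (k + l) → V)
    (a : Fin k) (x : V) :
    (fun j => Function.update v (Fin.castAdd l a) x (Fin.natAdd k j)) =
      fun j => v (Fin.natAdd k j) := by
  ext j
  exact Function.update_of_ne (by intro h; simp [Fin.ext_iff] at h; omega) _ _

theorem update_natAdd_left {k l : ℕ} [DecidableEq (Fin (k + l))] (v : Fin (k + l) → V)
    (b : Fin l) (x : V) :
    (fun i => Function.update v (Fin.natAdd k b) x (Fin.castAdd l i)) =
      fun i => v (Fin.castAdd l i) := by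
  ext i
  exact Function.update_of_ne (by intro h; simp [Fin.ext_iff] at h; omega) _ _

theorem update_natAdd_right {k l : ℕ} [DecidableEq (Fin (k + l))] (v : Fin (k + l) → V)
    (b : Fin l) (x : V) :
    (fun j => Function.update v (Fin.natAdd k b) x (Fin.natAdd k j)) =
      Function.update (fun j => v (Fin.natAdd k j)) b x := by
  ext j
  by_cases h : j = b
  · subst h; simp
  · rw [Function.update_of_ne h, Function.update_of_ne (by simpa using h)]

/-- The tensor product `α ⊗ β` of two alternating forms, as a multilinear map:
`(v₁, …, v_{k+l}) ↦ α (v₁, …, v_k) * β (v_{k+1}, …, v_{k+l})`. -/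
def tensor {k l : ℕ} (α : V [⋀^Fin k]→L[ℝ] ℝ) (β : V [⋀^Fin l]→L[ℝ] ℝ) :
    ContinuousMultilinearMap ℝ (fun _ : Fin (k + l) => V) ℝ where
  toFun v := α (fun i => v (Fin.castAdd l i)) * β (fun j => v (Fin.natAdd k j))
  map_update_add' := by
    intro _ v i x y
    refine Fin.addCases (fun a => ?_) (fun b => ?_) i
    · simp only [update_castAdd_left, update_castAdd_right, ContinuousAlternatingMap.map_update_add,
        add_mul]
    · simp only [update_natAdd_left, update_natAdd_right, ContinuousAlternatingMap.map_update_add,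
        mul_add]
  map_update_smul' := by
    intro _ v i c x
    refine Fin.addCases (fun a => ?_) (fun b => ?_) i
    · simp only [update_castAdd_left, update_castAdd_right, ContinuousAlternatingMap.map_update_smul,
        smul_eq_mul, mul_assoc]
    · simp only [update_natAdd_left, update_natAdd_right, ContinuousAlternatingMap.map_update_smul,
        smul_eq_mul, mul_left_comm]
  cont := by
    refine Continuous.mul (α.cont.comp ?_) (β.cont.comp ?_) <;> fun_prop

/-- The wedge product, normalised so that
`(α ∧ β)(v) = 1 / (k! l!) ∑_σ sign σ α(v_{σ 1}, …, v_{σ k}) β(v_{σ (k+1)}, …, v_{σ (k+l)})`. -/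
def wedge {k l : ℕ} (α : V [⋀^Fin k]→L[ℝ] ℝ) (β : V [⋀^Fin l]→L[ℝ] ℝ) :
    V [⋀^Fin (k + l)]→L[ℝ] ℝ :=
  ((k ! : ℝ) * (l ! : ℝ))⁻¹ • ContinuousMultilinearMap.alternatization (tensor α β)

end Algebra

/-- The model space `ℝ⁷`. -/
abbrev E7 : Type := EuclideanSpace ℝ (Fin 7)

/-- The standard basis vectors of `ℝ⁷`, indexed from `0` to `6`. -/
def basisVec (i : Fin 7) : E7 := EuclideanSpace.single i 1

/-- The coordinate one-form `e^i` on `ℝ⁷`. -/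
def dx (i : Fin 7) : E7 [⋀^Fin 1]→L[ℝ] ℝ :=
  ContinuousAlternatingMap.ofSubsingleton ℝ E7 ℝ 0 (EuclideanSpace.proj i)

/-- The monomial three-form `e^{ijk} = e^i ∧ e^j ∧ e^k` on `ℝ⁷`. -/
def dx3 (i j k : Fin 7) : E7 [⋀^Fin 3]→L[ℝ] ℝ := wedge (wedge (dx i) (dx j)) (dx k)

/-- The standard `G₂` three-form on `ℝ⁷`; with coordinates numbered from `1` it is
`e^{123} + e^{145} + e^{167} + e^{246} - e^{257} - e^{347} - e^{356}`,
that is `e^1 ∧ ω + Re Ψ` with `ω = e^{23} + e^{45} + e^{67}` and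
`Ψ = (e^2 + i e^3) ∧ (e^4 + i e^5) ∧ (e^6 + i e^7)`. -/
def phi0 : E7 [⋀^Fin 3]→L[ℝ] ℝ :=
  dx3 0 1 2 + dx3 0 3 4 + dx3 0 5 6 + dx3 1 3 5 - dx3 1 4 6 - dx3 2 3 6 - dx3 2 4 5

/-- The standard volume form of `ℝ⁷` evaluated on seven vectors. -/
def vol0 (v : Fin 7 → E7) : ℝ := Matrix.det (Matrix.of fun i j => v i j)

theorem append_update {k q : ℕ} (h : k + q = 7) [DecidableEq (Fin q)] (u : Fin k → E7)
    (w : Fin q → E7) (b : Fin q) (x : E7) :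
    (fun m => Fin.append u (Function.update w b x) (Fin.cast h.symm m)) =
      Function.update (fun m => Fin.append u w (Fin.cast h.symm m))
        (Fin.cast h (Fin.natAdd k b)) x := by
  funext m
  obtain ⟨n, rfl⟩ : ∃ n, m = Fin.cast h n := ⟨Fin.cast h.symm m, by simp⟩
  refine Fin.addCases (fun a => ?_) (fun c => ?_) n
  · rw [Function.update_of_ne (by intro h'; simp [Fin.ext_iff] at h'; omega)]
    simp
  · by_cases hc : c = b
    · subst hc; simp
    · rw [Function.update_of_ne (by simpa [Fin.ext_iff] using hc)]
      simp [Function.update_of_ne hc]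

theorem vol0_update_add (v : Fin 7 → E7) (i : Fin 7) (x y : E7) :
    vol0 (Function.update v i (x + y)) =
      vol0 (Function.update v i x) + vol0 (Function.update v i y) := by
  have key : ∀ z : E7, (Matrix.of fun a j => Function.update v i z a j) =
      Matrix.updateRow (Matrix.of fun a j => v a j) i (fun j => z j) := by
    intro z
    ext a j
    by_cases ha : a = i
    · subst ha; simp
    · simp [Function.update_of_ne ha, Matrix.updateRow_ne ha]
  simp only [vol0, key]
  rw [← Matrix.det_updateRow_add]
  rfl

theorem vol0_update_smul (v : Fin 7 → E7) (i : Fin 7) (c : ℝ) (x : E7) :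
    vol0 (Function.update v i (c • x)) = c * vol0 (Function.update v i x) := by
  have key : ∀ z : E7, (Matrix.of fun a j => Function.update v i z a j) =
      Matrix.updateRow (Matrix.of fun a j => v a j) i (fun j => z j) := by
    intro z
    ext a j
    by_cases ha : a = i
    · subst ha; simp
    · simp [Function.update_of_ne ha, Matrix.updateRow_ne ha]
  simp only [vol0, key]
  rw [← Matrix.det_updateRow_smul]
  rfl

/-- The Hodge star `Λ^k → Λ^q`, `k + q = 7`, of the Euclidean metric and the standard orientation
of `ℝ⁷`: `(*α)(w) = 1/k! ∑_{i₁ … i_k} α(e_{i₁}, …, e_{i_k}) vol(e_{i₁}, …, e_{i_k}, w)`. -/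
def hodge0 {k q : ℕ} (h : k + q = 7) (α : E7 [⋀^Fin k]→L[ℝ] ℝ) : E7 [⋀^Fin q]→L[ℝ] ℝ where
  toFun w := (k ! : ℝ)⁻¹ * ∑ i : Fin k → Fin 7, α (fun a => basisVec (i a)) *
    vol0 (fun m => Fin.append (fun a => basisVec (i a)) w (Fin.cast h.symm m))
  map_update_add' := by
    intro _ w b x y
    simp only [append_update h, vol0_update_add, mul_add, Finset.sum_add_distrib]
  map_update_smul' := by
    intro _ w b c x
    simp only [append_update h, vol0_update_smul, smul_eq_mul, Finset.mul_sum]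
    exact Finset.sum_congr rfl fun i _ => by ring
  cont := by
    refine continuous_const.mul (continuous_finsetSum _ fun i _ => continuous_const.mul ?_)
    refine Continuous.matrix_det (continuous_matrix fun m j => ?_)
    obtain ⟨n, rfl⟩ : ∃ n, m = Fin.cast h n := ⟨Fin.cast h.symm m, by simp⟩
    refine Fin.addCases (fun a => ?_) (fun c => ?_) n
    · simp only [Matrix.of_apply, Fin.cast_cast, Fin.cast_eq_self, Fin.append_left]
      exact continuous_const
    · simp only [Matrix.of_apply, Fin.cast_cast, Fin.cast_eq_self, Fin.append_right]
      fun_prop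
  map_eq_zero_of_eq' := by
    intro w b c hbc hne
    rw [Finset.sum_eq_zero, mul_zero]
    intro i _
    rw [vol0, Matrix.det_zero_of_row_eq (i := Fin.cast h (Fin.natAdd k b))
      (j := Fin.cast h (Fin.natAdd k c)), mul_zero]
    · simpa [Fin.ext_iff] using hne
    · ext j
      simp [hbc]

/-- The contraction `a ⌟ β` of a form `β` with a one-form `a` on Euclidean `ℝ⁷`: the vector
metrically dual to `a` is inserted in the first slot of `β`. -/
def contract0 {k : ℕ} (a : E7 [⋀^Fin 1]→L[ℝ] ℝ) (β : E7 [⋀^Fin (k + 1)]→L[ℝ] ℝ) :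
    E7 [⋀^Fin k]→L[ℝ] ℝ :=
  β.curryLeft (∑ i : Fin 7, a (fun _ => basisVec i) • basisVec i)

/-! ### Differential forms on a seven-manifold -/

section Manifold

variable {Y : Type*} [TopologicalSpace Y] [ChartedSpace E7 Y]

/-- (Not necessarily smooth) differential `k`-forms on the seven-manifold `Y`. -/
abbrev Form (Y : Type*) [TopologicalSpace Y] [ChartedSpace E7 Y] (k : ℕ) : Type _ :=
  ∀ x : Y, TangentSpace (𝓡 7) x [⋀^Fin k]→L[ℝ] ℝ

/-- The expression of a form in the chart `e`, that is its pullback along `e.symm`. -/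
def inChart {k : ℕ} (e : OpenPartialHomeomorph Y E7) (α : Form Y k) (z : E7) :
    E7 [⋀^Fin k]→L[ℝ] ℝ :=
  (α (e.symm z)).compContinuousLinearMap (mfderiv (𝓡 7) (𝓡 7) e.symm z)

/-- A form is smooth if its expressions in all the charts of the atlas are smooth. -/
def IsSmooth {k : ℕ} (α : Form Y k) : Prop :=
  ∀ e ∈ atlas E7 Y, ContDiffOn ℝ ∞ (inChart e α) e.target

/-- The exterior derivative of a `k`-form, computed at `x` in the preferred chart around `x`. -/
def d {k : ℕ} (α : Form Y k) : Form Y (k + 1) := fun x =>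
  (extDeriv (inChart (chartAt E7 x) α) (chartAt E7 x x)).compContinuousLinearMap
    (mfderiv (𝓡 7) (𝓡 7) (chartAt E7 x) x)

/-- The differential of a function, as a one-form. -/
def dFun (f : Y → ℝ) : Form Y 1 := fun x =>
  ContinuousAlternatingMap.ofSubsingleton ℝ (TangentSpace (𝓡 7) x) ℝ 0 (mvfderiv (𝓡 7) f x)

/-- A function regarded as a zero-form. -/
def ofFun (f : Y → ℝ) : Form Y 0 := fun x =>
  ContinuousAlternatingMap.constOfIsEmpty ℝ (TangentSpace (𝓡 7) x) (Fin 0) (f x)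

/-- The product of a function and a form. -/
def fmul {k : ℕ} (f : Y → ℝ) (α : Form Y k) : Form Y k := fun x => f x • α x

/-- The wedge product of forms. -/
def fwedge {k l : ℕ} (α : Form Y k) (β : Form Y l) : Form Y (k + l) := fun x => wedge (α x) (β x)

/-- The lowest order Bianchi identities: `H` is closed and `f` is constant. -/
def Bianchi (H : Form Y 3) (f : Y → ℝ) : Prop := d H = 0 ∧ ∃ c : ℝ, ∀ y, f y = c

end Manifold

/-! ### `G₂` structures -/

/-- A `G₂` structure on `Y`: a smooth three-form that is positive, that is, identified with the
standard three-form `phi0` by some linear isomorphism `T_x Y ≃ ℝ⁷` at every point. -/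
structure G2Structure (Y : Type*) [TopologicalSpace Y] [ChartedSpace E7 Y] where
  /-- The three-form `φ`. -/
  form : Form Y 3
  smooth : IsSmooth form
  positive : ∀ x, ∃ u : TangentSpace (𝓡 7) x ≃L[ℝ] E7,
    form x = phi0.compContinuousLinearMap (u : TangentSpace (𝓡 7) x →L[ℝ] E7)

namespace G2Structure

variable {Y : Type*} [TopologicalSpace Y] [ChartedSpace E7 Y] (G : G2Structure Y)

/-- An adapted frame at `x`: an isomorphism `T_x Y ≃ ℝ⁷` that takes `φ` to `phi0`. The metric and
the orientation induced by `φ` are those that it pulls back from `ℝ⁷`; since two adapted frames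
differ by an element of the stabiliser `G₂ ⊆ SO(7)` of `phi0`, they (and the operators below) do
not depend on the frame. -/
def frame (x : Y) : TangentSpace (𝓡 7) x ≃L[ℝ] E7 := (G.positive x).choose

/-- The Hodge star on `k`-forms of the metric and orientation induced by `φ`. -/
def hodge {k q : ℕ} (h : k + q = 7) (α : Form Y k) : Form Y q := fun x =>
  (hodge0 h ((α x).compContinuousLinearMap
      ((G.frame x).symm : E7 →L[ℝ] TangentSpace (𝓡 7) x))).compContinuousLinearMap
    (G.frame x : TangentSpace (𝓡 7) x →L[ℝ] E7)

/-- The contraction `a ⌟ β` of a form with a one-form, in the metric induced by `φ`. -/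
def contract {k : ℕ} (a : Form Y 1) (β : Form Y (k + 1)) : Form Y k := fun x =>
  (contract0
      ((a x).compContinuousLinearMap ((G.frame x).symm : E7 →L[ℝ] TangentSpace (𝓡 7) x))
      ((β x).compContinuousLinearMap
        ((G.frame x).symm : E7 →L[ℝ] TangentSpace (𝓡 7) x))).compContinuousLinearMap
    (G.frame x : TangentSpace (𝓡 7) x →L[ℝ] E7)

/-- The four-form `ψ = *φ`. -/
def psi : Form Y 4 := G.hodge (k := 3) (q := 4) rfl G.form

/-- `τ₀, τ₁, τ₂, τ₃` are the torsion classes of the `G₂` structure: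
`dφ = τ₀ ψ + 3 τ₁ ∧ φ + *τ₃` and `dψ = 4 τ₁ ∧ ψ + *τ₂`, where `τ₂` lies in `Λ²₁₄`
(that is, `τ₂ ∧ ψ = 0`) and `τ₃` lies in `Λ³₂₇` (that is, `φ ∧ *τ₃ = 0` and `τ₃ ∧ φ = 0`).
These conditions determine the four forms. -/
structure IsTorsion (τ₀ : Y → ℝ) (τ₁ : Form Y 1) (τ₂ : Form Y 2) (τ₃ : Form Y 3) : Prop where
  d_form : (d G.form : Form Y 4) = fmul τ₀ G.psi + (3 : ℝ) • (fwedge τ₁ G.form : Form Y 4)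
    + G.hodge (k := 3) (q := 4) rfl τ₃
  d_psi : (d G.psi : Form Y 5) = (4 : ℝ) • (fwedge τ₁ G.psi : Form Y 5)
    + G.hodge (k := 2) (q := 5) rfl τ₂
  two_mem : fwedge τ₂ G.psi = 0
  form_wedge_star_three : fwedge G.form (G.hodge (k := 3) (q := 4) rfl τ₃) = 0
  three_wedge_form : fwedge τ₃ G.form = 0

/-- The Killing spinor equations for the `G₂` structure `φ`, the dilaton `ϕ`, the flux `H` along
`Y` and the flux component `f` along the three-dimensional space-time. -/
structure KillingSpinor (ϕ : Y → ℝ) (H : Form Y 3) (f : Y → ℝ) : Prop where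
  d_form : (d G.form : Form Y 4) = (2 : ℝ) • (fwedge (dFun ϕ) G.form : Form Y 4)
    - G.hodge (k := 3) (q := 4) rfl H - fmul f G.psi
  d_psi : (d G.psi : Form Y 5) = (2 : ℝ) • (fwedge (dFun ϕ) G.psi : Form Y 5)
  star_d_dilaton : G.hodge (k := 1) (q := 6) rfl (dFun ϕ)
    = -((1 / 2 : ℝ) • (fwedge H G.form : Form Y 6))
  star_f : (1 / 2 : ℝ) • G.hodge (k := 0) (q := 7) rfl (ofFun f) = (fwedge H G.psi : Form Y 7)

/-- `H = (1/14) f φ + Hp` with `Hp` orthogonal to `φ`. -/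
structure IsFluxDecomposition (H : Form Y 3) (f : Y → ℝ) (Hp : Form Y 3) : Prop where
  eq : H = fmul (fun y => 1 / 14 * f y) G.form + Hp
  wedge_psi : fwedge Hp G.psi = 0
  star_wedge_form : fwedge (G.hodge (k := 3) (q := 4) rfl Hp) G.form = 0

/-- The flux equation of motion `d (* e^{-2ϕ} H) = 0`. -/
def FluxEOM (ϕ : Y → ℝ) (H : Form Y 3) : Prop :=
  d (G.hodge (k := 3) (q := 4) rfl (fmul (fun y => Real.exp (-2 * ϕ y)) H)) = 0

end G2Structure

end HetG2

end

open scoped Manifold ContDiff Nat Topology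

namespace HetG2

/-! ### Tuples and volumes -/

/-! The first claim is linear algebra at each point. Put `Hp = H - (f/14) φ`. Since `φ ∧ ψ = 7 vol`,
the equation `½ *f = H ∧ ψ` says exactly `Hp ∧ ψ = 0`, and `*Hp ∧ φ = Hp ∧ ψ` because both are `⟨Hp,
φ⟩ vol`. From `*(a ⌟ ψ) = -a ∧ φ`, the form `τ₃ = -Hp - ½ dϕ ⌟ ψ` has `*τ₃ = -*Hp + ½ dϕ ∧ φ`, and
the two expressions for `dφ` and for `dψ` then match coefficient by coefficient. From `(a ⌟ ψ) ∧ φ =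
4 *a` and `φ ∧ φ = 0`, the condition `τ₃ ∧ φ = 0` is the dilaton equation. The remaining condition
`φ ∧ *τ₃ = 0` follows from `Hp ∧ ψ = 0` and `φ ∧ (a ∧ φ) = 0`.

These identities are proved on `ℝ⁷` and carried over by adapted frames. The star is an involution
(`hodge0_hodge0`), so identities of forms may be checked after applying it, where `hodge0_wedge`
turns a wedge product into a sum of volumes. What is special to `G₂` is a few contractions of the
integer components of `φ` and `ψ`, evaluated by the kernel.

For the second claim, the equation for `dφ` gives `e^{-2ϕ} *H = -d(e^{-2ϕ} φ) - f e^{-2ϕ} ψ`. With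
`f` constant this is closed: `d² = 0`, and `d(e^{-2ϕ} ψ) = 0` by the equation for `dψ`. This needs a
chart-independent `d` (`inChart_d`), a Leibniz rule for the present normalisation of the wedge, and
differentiability of `ψ`. The last point is not automatic, because `ψ` is built from frames picked
by choice at each point. It is settled by `psiOf`, a frame-free formula for `ψ` in terms of `φ`,
differentiable at positive forms. -/

/-- The tuple of basis vectors with the given indices. -/
noncomputable def basisTuple {k : ℕ} (I : Fin k → Fin 7) : Fin k → E7 := fun a => basisVec (I a)

/-- The standard volume form evaluated on a concatenated tuple. -/
noncomputable def volAppend {k q : ℕ} (h : k + q = 7) (u : Fin k → E7) (w : Fin q → E7) : ℝ :=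
  vol0 fun m => Fin.append u w (Fin.cast h.symm m)

theorem hodge0_apply {k q : ℕ} (h : k + q = 7) (α : E7 [⋀^Fin k]→L[ℝ] ℝ) (w : Fin q → E7) :
    hodge0 h α w = (k ! : ℝ)⁻¹ *
      ∑ I : Fin k → Fin 7, α (basisTuple I) * volAppend h (basisTuple I) w := rfl

theorem sum_append {ι M : Type*} [Fintype ι] [AddCommMonoid M] {k l : ℕ}
    (F : (Fin (k + l) → ι) → M) :
    ∑ K, F K = ∑ I : Fin k → ι, ∑ J : Fin l → ι, F (Fin.append I J) := by
  rw [← (Fin.appendEquiv k l).sum_comp, Fintype.sum_prod_type]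
  rfl

theorem basisTuple_append {k l : ℕ} (I : Fin k → Fin 7) (J : Fin l → Fin 7) :
    basisTuple (Fin.append I J) = Fin.append (basisTuple I) (basisTuple J) := by
  funext m
  refine Fin.addCases (fun a => ?_) (fun a => ?_) m <;> simp [basisTuple]

theorem vol0_comp_perm (v : Fin 7 → E7) (σ : Equiv.Perm (Fin 7)) :
    vol0 (v ∘ σ) = Equiv.Perm.sign σ * vol0 v :=
  Matrix.det_permute σ (Matrix.of fun i j => v i j)

theorem vol0_eq_zero_of_eq {v : Fin 7 → E7} {i j : Fin 7} (h : v i = v j) (hij : i ≠ j) :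
    vol0 v = 0 :=
  Matrix.det_zero_of_row_eq hij (by ext m; simp [h])

theorem vol0_basisVec : vol0 basisVec = 1 := by
  rw [vol0, ← Matrix.det_one (n := Fin 7) (R := ℝ)]
  congr 1
  ext i j
  simp [basisVec, Matrix.one_apply, eq_comm]

theorem vol0_basis_sq {K : Fin 7 → Fin 7} (hK : Function.Injective K) :
    vol0 (basisTuple K) * vol0 (basisTuple K) = 1 := by
  have h : basisTuple K = basisVec ∘ Equiv.ofBijective K (Finite.injective_iff_bijective.1 hK) :=
    rfl
  rw [h, vol0_comp_perm, vol0_basisVec, mul_one, ← Int.cast_mul, ← Units.val_mul,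
    Int.units_mul_self]
  simp

theorem volAppend_comp_perm {k q : ℕ} (h : k + q = 7) (u : Fin k → E7) (w : Fin q → E7)
    (σ : Equiv.Perm (Fin k)) :
    volAppend h (u ∘ σ) w = Equiv.Perm.sign σ * volAppend h u w := by
  have key : (fun m => Fin.append (u ∘ σ) w (Fin.cast h.symm m)) =
      (fun m => Fin.append u w (Fin.cast h.symm m)) ∘
        (finSumFinEquiv.trans (finCongr h)).permCongr (Equiv.Perm.sumCongr σ 1) := by
    funext m
    obtain ⟨n, rfl⟩ := (finSumFinEquiv.trans (finCongr h)).surjective m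
    rcases n with a | a <;> simp
  rw [volAppend, key, vol0_comp_perm, Equiv.Perm.sign_permCongr, Equiv.Perm.sign_sumCongr]
  simp [volAppend]

/-- Exchanging the blocks is a power of the 7-cycle `finRotate 7`, an even permutation. This is why
no signs appear in the star of an odd-dimensional space. -/
theorem volAppend_swap {k q : ℕ} (h : k + q = 7) (h' : q + k = 7) (u : Fin k → E7)
    (w : Fin q → E7) : volAppend h' w u = volAppend h u w := by
  have key : (fun m => Fin.append w u (Fin.cast h'.symm m)) =
      (fun m => Fin.append u w (Fin.cast h.symm m)) ∘ (finRotate 7 ^ k) := by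
    have hk : k ≤ 7 := by omega
    obtain rfl : q = 7 - k := by omega
    interval_cases k <;> (funext m; fin_cases m <;> rfl)
  rw [volAppend, key, vol0_comp_perm, map_pow, sign_finRotate]
  simp [volAppend]

theorem injective_append_of_volAppend_ne_zero {k q : ℕ} {h : k + q = 7} {I : Fin k → Fin 7}
    {J : Fin q → Fin 7} (hIJ : volAppend h (basisTuple I) (basisTuple J) ≠ 0) :
    Function.Injective (Fin.append I J) := by
  intro a b hab
  by_contra hne
  refine hIJ (vol0_eq_zero_of_eq (i := Fin.cast h a) (j := Fin.cast h b) ?_ (by simpa using hne))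
  rw [← basisTuple_append]
  simp [basisTuple, hab]

/-- Both `J` and `J'` enumerate the complement of the range of `I`. -/
theorem exists_perm_of_injective_append {k q : ℕ} (h : k + q = 7) {I : Fin k → Fin 7}
    {J J' : Fin q → Fin 7} (hJ : Function.Injective (Fin.append I J))
    (hJ' : Function.Injective (Fin.append I J')) : ∃ ρ : Equiv.Perm (Fin q), J' = J ∘ ρ := by
  have hsurj : Function.Surjective (Fin.append I J) :=
    ((Fintype.bijective_iff_injective_and_card _).2 ⟨hJ, by simp [h]⟩).2
  have hex : ∀ b, ∃ c, J' b = J c := by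
    intro b
    obtain ⟨m, hm⟩ := hsurj (J' b)
    induction m using Fin.addCases with
    | left a =>
      have := @hJ' (Fin.castAdd q a) (Fin.natAdd k b) (by simpa using hm)
      simp [Fin.ext_iff] at this
      omega
    | right c => exact ⟨c, by simpa using hm.symm⟩
  choose f hf using hex
  have hinj : Function.Injective f := by
    intro b b' hbb
    have := @hJ' (Fin.natAdd k b) (Fin.natAdd k b') (by simp [hf, hbb])
    simpa using this
  exact ⟨Equiv.ofBijective f (Finite.injective_iff_bijective.1 hinj), funext hf⟩

theorem exists_injective_append {k q : ℕ} (h : k + q = 7) {I : Fin k → Fin 7}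
    (hI : Function.Injective I) : ∃ J : Fin q → Fin 7, Function.Injective (Fin.append I J) := by
  classical
  have hc : ((Finset.univ.image I)ᶜ).card = q := by
    rw [Finset.card_compl, Finset.card_image_of_injective _ hI]
    simp
    omega
  refine ⟨((Finset.univ.image I)ᶜ).orderEmbOfFin hc, ?_⟩
  refine Fin.append_injective_iff.2 ⟨hI, (Finset.orderEmbOfFin _ hc).injective, ?_⟩
  intro a b hab
  have := Finset.orderEmbOfFin_mem _ hc b
  rw [← hab] at this
  simp at this

/-- Reduces the sum in the star to the `q!` orderings of one complementary tuple, to be cancelled by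
the factorial in front. -/
theorem sum_eq_sum_perm {q : ℕ} {M : Type*} [AddCommMonoid M] {J : Fin q → Fin 7}
    (hJ : Function.Injective J) (g : (Fin q → Fin 7) → M)
    (hg : ∀ J', g J' ≠ 0 → ∃ ρ : Equiv.Perm (Fin q), J' = J ∘ ρ) :
    ∑ J', g J' = ∑ ρ : Equiv.Perm (Fin q), g (J ∘ ρ) := by
  symm
  refine Finset.sum_of_injOn (fun ρ : Equiv.Perm (Fin q) => J ∘ ρ) ?_ (by simp) ?_ (by simp)
  · intro ρ _ ρ' _ hρ
    ext b
    exact congrArg _ (hJ (congrFun hρ b))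
  · intro J' _ hJ'
    by_contra hne
    obtain ⟨ρ, rfl⟩ := hg J' hne
    exact hJ' ⟨ρ, by simp⟩

theorem ext_basisTuple {k : ℕ} {α β : E7 [⋀^Fin k]→L[ℝ] ℝ}
    (h : ∀ I : Fin k → Fin 7, Function.Injective I → α (basisTuple I) = β (basisTuple I)) :
    α = β := by
  apply ContinuousAlternatingMap.toAlternatingMap_injective
  refine Module.Basis.ext_alternating (EuclideanSpace.basisFun (Fin 7) ℝ).toBasis fun I hI => ?_
  simp only [OrthonormalBasis.coe_toBasis, EuclideanSpace.basisFun_apply]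
  exact h I hI

theorem comp_perm_apply {k : ℕ} (α : E7 [⋀^Fin k]→L[ℝ] ℝ) (v : Fin k → E7)
    (σ : Equiv.Perm (Fin k)) : α (v ∘ σ) = Equiv.Perm.sign σ * α v := by
  have := α.toAlternatingMap.map_perm v σ
  simp only [ContinuousAlternatingMap.coe_toAlternatingMap, Units.smul_def, zsmul_eq_mul] at this
  exact this

theorem sign_mul_sign {k : ℕ} (σ : Equiv.Perm (Fin k)) :
    ((Equiv.Perm.sign σ : ℤ) : ℝ) * ((Equiv.Perm.sign σ : ℤ) : ℝ) = 1 := by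
  rw [← Int.cast_mul, ← Units.val_mul, Int.units_mul_self]
  simp

/-- In dimension seven the Hodge star is an involution. -/
theorem hodge0_hodge0 {k q : ℕ} (h : k + q = 7) (h' : q + k = 7) (α : E7 [⋀^Fin k]→L[ℝ] ℝ) :
    hodge0 h' (hodge0 h α) = α := by
  refine ext_basisTuple fun K hK => ?_
  obtain ⟨J, hJ⟩ := exists_injective_append h hK
  have hJi : Function.Injective J := (Fin.append_injective_iff.1 hJ).2.1
  have hsq : volAppend h (basisTuple K) (basisTuple J) *
      volAppend h (basisTuple K) (basisTuple J) = 1 := by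
    have := vol0_basis_sq (K := fun m => Fin.append K J (Fin.cast h.symm m))
      (hJ.comp (Fin.cast_injective _))
    have e : (basisTuple fun m => Fin.append K J (Fin.cast h.symm m)) =
        fun m => Fin.append (basisTuple K) (basisTuple J) (Fin.cast h.symm m) := by
      rw [← basisTuple_append]; rfl
    rwa [e] at this
  -- The sign of `ρ` and the volume `±1` of `(K, J)` each enter twice, once per star, so every
  -- ordering contributes the same value.
  have hterm : ∀ ρ : Equiv.Perm (Fin q), hodge0 h α (basisTuple (J ∘ ρ)) *
      volAppend h' (basisTuple (J ∘ ρ)) (basisTuple K) = α (basisTuple K) := by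
    intro ρ
    have hJρ : volAppend h' (basisTuple (J ∘ ρ)) (basisTuple K) =
      Equiv.Perm.sign ρ * volAppend h (basisTuple K) (basisTuple J) := by
      rw [← volAppend_swap h h']
      exact volAppend_comp_perm h' (basisTuple J) _ ρ
    have hinj : ∀ I : Fin k → Fin 7, α (basisTuple I) *
        volAppend h (basisTuple I) (basisTuple J) ≠ 0 → ∃ π : Equiv.Perm (Fin k), I = K ∘ π := by
      intro I hI
      have hne := right_ne_zero_of_mul hI
      rw [← volAppend_swap h h'] at hne
      have h1 := injective_append_of_volAppend_ne_zero hne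
      refine exists_perm_of_injective_append h' (I := J) ?_ h1
      have h2 := Fin.append_injective_iff.1 hJ
      exact Fin.append_injective_iff.2 ⟨h2.2.1, h2.1, fun a b => (h2.2.2 b a).symm⟩
    have hπ : ∀ π : Equiv.Perm (Fin k), α (basisTuple (K ∘ π)) *
        volAppend h (basisTuple (K ∘ π)) (basisTuple J) =
        α (basisTuple K) * volAppend h (basisTuple K) (basisTuple J) := by
      intro π
      have e1 := comp_perm_apply α (basisTuple K) π
      have e2 := volAppend_comp_perm h (basisTuple K) (basisTuple J) π
      change α (basisTuple K ∘ π) * volAppend h (basisTuple K ∘ π) _ = _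
      rw [e1, e2]
      linear_combination (α (basisTuple K) * volAppend h (basisTuple K) (basisTuple J)) *
        sign_mul_sign π
    have hρ : hodge0 h α (basisTuple (J ∘ ρ)) = Equiv.Perm.sign ρ * hodge0 h α (basisTuple J) :=
      comp_perm_apply _ (basisTuple J) ρ
    rw [hρ, hJρ, hodge0_apply, sum_eq_sum_perm hK _ hinj, Finset.sum_congr rfl fun π _ => hπ π]
    simp only [Finset.sum_const, Finset.card_univ, Fintype.card_perm, Fintype.card_fin,
      nsmul_eq_mul]
    have hk : (k ! : ℝ) ≠ 0 := by positivity
    rw [inv_mul_cancel_left₀ hk]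
    linear_combination (Equiv.Perm.sign ρ * Equiv.Perm.sign ρ * α (basisTuple K)) * hsq +
      α (basisTuple K) * sign_mul_sign ρ
  rw [hodge0_apply, sum_eq_sum_perm hJi]
  · rw [Finset.sum_congr rfl fun ρ _ => hterm ρ]
    have hq : (q ! : ℝ) ≠ 0 := by positivity
    simp only [Finset.sum_const, Finset.card_univ, Fintype.card_perm, Fintype.card_fin,
      nsmul_eq_mul]
    rw [inv_mul_cancel_left₀ hq]
  · intro J' hJ'
    have hne := right_ne_zero_of_mul hJ'
    rw [volAppend_swap h h'] at hne
    exact exists_perm_of_injective_append h hJ (injective_append_of_volAppend_ne_zero hne)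

/-- Lets an identity of wedge products be checked after a star, where `hodge0_wedge` applies. -/
theorem hodge0_injective {k q : ℕ} (h : k + q = 7) : Function.Injective (hodge0 (k := k) h) := by
  intro α β hαβ
  rw [← hodge0_hodge0 h (by omega) α, hαβ, hodge0_hodge0]

/-! ### The wedge product -/

section Wedge

variable {V : Type*} [AddCommGroup V] [Module ℝ V] [TopologicalSpace V]
  {W : Type*} [AddCommGroup W] [Module ℝ W] [TopologicalSpace W]

theorem wedge_apply {k l : ℕ} (α : V [⋀^Fin k]→L[ℝ] ℝ) (β : V [⋀^Fin l]→L[ℝ] ℝ)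
    (v : Fin (k + l) → V) :
    wedge α β v = ((k ! : ℝ) * (l ! : ℝ))⁻¹ * ∑ σ : Equiv.Perm (Fin (k + l)),
      (Equiv.Perm.sign σ : ℝ) * (α (fun i => v (σ (Fin.castAdd l i))) *
        β (fun j => v (σ (Fin.natAdd k j)))) := by
  simp only [wedge, ContinuousAlternatingMap.smul_apply, smul_eq_mul]
  congr 1
  rw [ContinuousMultilinearMap.alternatization_apply_apply]
  exact Finset.sum_congr rfl fun σ _ => by
    rw [Units.smul_def, zsmul_eq_mul]; rfl

theorem wedge_add_left {k l : ℕ} (α α' : V [⋀^Fin k]→L[ℝ] ℝ) (β : V [⋀^Fin l]→L[ℝ] ℝ) :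
    wedge (α + α') β = wedge α β + wedge α' β := by
  ext v
  simp only [wedge_apply, ContinuousAlternatingMap.add_apply, add_mul, mul_add,
    Finset.sum_add_distrib]

theorem wedge_add_right {k l : ℕ} (α : V [⋀^Fin k]→L[ℝ] ℝ) (β β' : V [⋀^Fin l]→L[ℝ] ℝ) :
    wedge α (β + β') = wedge α β + wedge α β' := by
  ext v
  simp only [wedge_apply, ContinuousAlternatingMap.add_apply, mul_add,
    Finset.sum_add_distrib]

theorem wedge_smul_left {k l : ℕ} (c : ℝ) (α : V [⋀^Fin k]→L[ℝ] ℝ) (β : V [⋀^Fin l]→L[ℝ] ℝ) :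
    wedge (c • α) β = c • wedge α β := by
  ext v
  simp only [wedge_apply, ContinuousAlternatingMap.smul_apply, smul_eq_mul, Finset.mul_sum]
  exact Finset.sum_congr rfl fun σ _ => by ring

theorem wedge_smul_right {k l : ℕ} (c : ℝ) (α : V [⋀^Fin k]→L[ℝ] ℝ) (β : V [⋀^Fin l]→L[ℝ] ℝ) :
    wedge α (c • β) = c • wedge α β := by
  ext v
  simp only [wedge_apply, ContinuousAlternatingMap.smul_apply, smul_eq_mul, Finset.mul_sum]
  exact Finset.sum_congr rfl fun σ _ => by ring

theorem wedge_compContinuousLinearMap {k l : ℕ} (α : V [⋀^Fin k]→L[ℝ] ℝ)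
    (β : V [⋀^Fin l]→L[ℝ] ℝ) (A : W →L[ℝ] V) :
    (wedge α β).compContinuousLinearMap A =
      wedge (α.compContinuousLinearMap A) (β.compContinuousLinearMap A) := by
  ext v
  simp only [wedge_apply, ContinuousAlternatingMap.compContinuousLinearMap_apply]
  rfl

end Wedge

theorem hodge0_add {k q : ℕ} (h : k + q = 7) (α β : E7 [⋀^Fin k]→L[ℝ] ℝ) :
    hodge0 h (α + β) = hodge0 h α + hodge0 h β := by
  ext w
  simp only [hodge0_apply, ContinuousAlternatingMap.add_apply, add_mul, mul_add,
    Finset.sum_add_distrib]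

theorem hodge0_smul {k q : ℕ} (h : k + q = 7) (c : ℝ) (α : E7 [⋀^Fin k]→L[ℝ] ℝ) :
    hodge0 h (c • α) = c • hodge0 h α := by
  ext w
  simp only [hodge0_apply, ContinuousAlternatingMap.smul_apply, smul_eq_mul, Finset.mul_sum]
  exact Finset.sum_congr rfl fun σ _ => by ring

theorem hodge0_neg {k q : ℕ} (h : k + q = 7) (α : E7 [⋀^Fin k]→L[ℝ] ℝ) :
    hodge0 h (-α) = -hodge0 h α := by
  rw [← neg_one_smul ℝ α, hodge0_smul]
  exact neg_one_smul ℝ (hodge0 h α)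

theorem hodge0_sub {k q : ℕ} (h : k + q = 7) (α β : E7 [⋀^Fin k]→L[ℝ] ℝ) :
    hodge0 h (α - β) = hodge0 h α - hodge0 h β := by
  rw [sub_eq_add_neg, hodge0_add, hodge0_neg, sub_eq_add_neg]

theorem hodge0_zero {k q : ℕ} (h : k + q = 7) : hodge0 h (0 : E7 [⋀^Fin k]→L[ℝ] ℝ) = 0 := by
  simpa using hodge0_smul h 0 0

/-- Relabelling the summation tuple by `σ` moves the sign of `σ` onto the volume, where it squares
away. The `(k + l)!` permutations thus contribute equally and cancel the factorial of the star. -/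
theorem hodge0_wedge {k l q : ℕ} (h : k + l + q = 7) (α : E7 [⋀^Fin k]→L[ℝ] ℝ)
    (β : E7 [⋀^Fin l]→L[ℝ] ℝ) (w : Fin q → E7) :
    hodge0 h (wedge α β) w = ((k ! : ℝ) * (l ! : ℝ))⁻¹ *
      ∑ I : Fin k → Fin 7, ∑ J : Fin l → Fin 7, α (basisTuple I) * β (basisTuple J) *
        volAppend h (Fin.append (basisTuple I) (basisTuple J)) w := by
  have key : ∀ σ : Equiv.Perm (Fin (k + l)), ∑ K : Fin (k + l) → Fin 7,
      (Equiv.Perm.sign σ : ℝ) * (α (fun i => basisTuple K (σ (Fin.castAdd l i))) *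
        β (fun j => basisTuple K (σ (Fin.natAdd k j)))) * volAppend h (basisTuple K) w =
      ∑ I : Fin k → Fin 7, ∑ J : Fin l → Fin 7, α (basisTuple I) * β (basisTuple J) *
        volAppend h (Fin.append (basisTuple I) (basisTuple J)) w := by
    intro σ
    rw [← (Equiv.arrowCongr σ (Equiv.refl (Fin 7))).sum_comp, sum_append]
    refine Finset.sum_congr rfl fun I _ => Finset.sum_congr rfl fun J _ => ?_
    have e := volAppend_comp_perm h (basisTuple (Fin.append I J)) w σ.symm
    change (Equiv.Perm.sign σ : ℝ) *
      (α (fun i => basisVec (Fin.append I J (σ.symm (σ (Fin.castAdd l i))))) *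
        β (fun j => basisVec (Fin.append I J (σ.symm (σ (Fin.natAdd k j)))))) *
        volAppend h (basisTuple (Fin.append I J) ∘ σ.symm) w = _
    rw [e, Equiv.Perm.sign_symm, basisTuple_append]
    simp only [Equiv.symm_apply_apply, Fin.append_left, Fin.append_right]
    change _ * (α (basisTuple I) * β (basisTuple J)) * _ = _
    linear_combination (α (basisTuple I) * β (basisTuple J) *
        volAppend h (Fin.append (basisTuple I) (basisTuple J)) w) * sign_mul_sign σ
  rw [hodge0_apply]
  simp only [wedge_apply]
  have : ∀ K : Fin (k + l) → Fin 7, ((k ! : ℝ) * (l ! : ℝ))⁻¹ *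
      (∑ σ : Equiv.Perm (Fin (k + l)), (Equiv.Perm.sign σ : ℝ) *
        (α (fun i => basisTuple K (σ (Fin.castAdd l i))) *
        β (fun j => basisTuple K (σ (Fin.natAdd k j))))) * volAppend h (basisTuple K) w =
      ((k ! : ℝ) * (l ! : ℝ))⁻¹ * ∑ σ : Equiv.Perm (Fin (k + l)), (Equiv.Perm.sign σ : ℝ) *
        (α (fun i => basisTuple K (σ (Fin.castAdd l i))) *
        β (fun j => basisTuple K (σ (Fin.natAdd k j)))) * volAppend h (basisTuple K) w := by
    intro K
    rw [mul_assoc, Finset.sum_mul]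
  rw [Finset.sum_congr rfl fun K _ => this K, ← Finset.mul_sum, Finset.sum_comm,
    Finset.sum_congr rfl fun σ _ => key σ, Finset.sum_const, Finset.card_univ, Fintype.card_perm,
    Fintype.card_fin, nsmul_eq_mul]
  have hkl : ((k + l)! : ℝ) ≠ 0 := by positivity
  field_simp

theorem append_fin_zero {k : ℕ} (h : k + 0 = 7) {k' q : ℕ} (hk : k' + q = k) (h' : k' + q = 7)
    (u : Fin k' → E7) (v : Fin q → E7) (w : Fin 0 → E7) :
    volAppend h (fun m => Fin.append u v (Fin.cast hk.symm m)) w = volAppend h' u v := by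
  obtain rfl : k = 7 := h
  rw [volAppend]
  congr 1
  funext m
  change Fin.append _ w (Fin.castAdd 0 m) = _
  rw [Fin.append_left]

/-- The inner product of two forms on Euclidean space. -/
noncomputable def formInner {k : ℕ} (α β : E7 [⋀^Fin k]→L[ℝ] ℝ) : ℝ :=
  (k ! : ℝ)⁻¹ * ∑ I : Fin k → Fin 7, α (basisTuple I) * β (basisTuple I)

theorem formInner_comm {k : ℕ} (α β : E7 [⋀^Fin k]→L[ℝ] ℝ) : formInner α β = formInner β α := by
  simp only [formInner, mul_comm]

/-- `*(α ∧ *β)` is the inner product of `α` and `β`. -/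
theorem hodge0_wedge_hodge0 {k q : ℕ} (h : k + q = 7) (h₀ : k + q + 0 = 7)
    (α β : E7 [⋀^Fin k]→L[ℝ] ℝ) :
    hodge0 h₀ (wedge α (hodge0 h β)) =
      ContinuousAlternatingMap.constOfIsEmpty ℝ E7 (Fin 0) (formInner α β) := by
  ext w
  have h' : q + k = 7 := by omega
  rw [hodge0_wedge, ContinuousAlternatingMap.constOfIsEmpty_apply, formInner, mul_inv, mul_assoc]
  congr 1
  rw [Finset.mul_sum]
  refine Finset.sum_congr rfl fun I _ => ?_
  -- Writing `β` as `**β` produces the same volumes as `hodge0_wedge` does on the left.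
  conv_rhs => rw [← hodge0_hodge0 h h' β, hodge0_apply]
  rw [mul_left_comm]
  congr 1
  rw [Finset.mul_sum]
  refine Finset.sum_congr rfl fun J _ => ?_
  rw [volAppend_swap h h', ← append_fin_zero h₀ rfl h _ _ w]
  simp only [mul_assoc]
  rfl

/-- Mirror image of `hodge0_wedge_hodge0`; there is no sign because `k * q` is even when `k + q =
7`. -/
theorem hodge0_hodge0_wedge {k q : ℕ} (h : k + q = 7) (h₀ : q + k + 0 = 7)
    (α β : E7 [⋀^Fin k]→L[ℝ] ℝ) :
    hodge0 h₀ (wedge (hodge0 h β) α) =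
      ContinuousAlternatingMap.constOfIsEmpty ℝ E7 (Fin 0) (formInner α β) := by
  ext w
  have h' : q + k = 7 := by omega
  rw [hodge0_wedge, ContinuousAlternatingMap.constOfIsEmpty_apply, formInner, mul_inv, mul_comm (q ! : ℝ)⁻¹, mul_assoc, Finset.sum_comm]
  congr 1
  rw [Finset.mul_sum]
  refine Finset.sum_congr rfl fun I _ => ?_
  conv_rhs => rw [← hodge0_hodge0 h h' β, hodge0_apply]
  rw [mul_left_comm]
  congr 1
  rw [Finset.mul_sum]
  refine Finset.sum_congr rfl fun J _ => ?_
  rw [← append_fin_zero h₀ rfl h' _ _ w, mul_right_comm, mul_comm]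
  rfl

/-! ### Contractions and reordering of volumes -/

theorem vol0_eq_of_perm (σ : Equiv.Perm (Fin 7)) {v v' : Fin 7 → E7} (h : ∀ m, v' m = v (σ m)) :
    vol0 v' = Equiv.Perm.sign σ * vol0 v := by
  rw [← vol0_comp_perm]
  exact congrArg vol0 (funext h)

theorem sum_tuple_succ {M : Type*} [AddCommMonoid M] {n : ℕ}
    (F : (Fin (n + 1) → Fin 7) → M) :
    ∑ I, F I = ∑ i, ∑ I : Fin n → Fin 7, F (Fin.cons i I) := by
  rw [← (Fin.consEquiv fun _ => Fin 7).sum_comp, Fintype.sum_prod_type]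
  rfl

theorem sum_tuple_one {M : Type*} [AddCommMonoid M] (F : (Fin 1 → Fin 7) → M) :
    ∑ I, F I = ∑ i, F fun _ => i :=
  (Equiv.funUnique (Fin 1) (Fin 7)).symm.sum_comp F |>.symm

theorem sum_tuple_three {M : Type*} [AddCommMonoid M] (F : (Fin 3 → Fin 7) → M) :
    ∑ I, F I = ∑ i, ∑ j, ∑ k, F ![i, j, k] := by
  simp only [sum_tuple_succ, Fintype.sum_unique]
  rfl

theorem contract0_apply {k : ℕ} (a : E7 [⋀^Fin 1]→L[ℝ] ℝ) (β : E7 [⋀^Fin (k + 1)]→L[ℝ] ℝ)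
    (w : Fin k → E7) :
    contract0 a β w = ∑ i, a (fun _ => basisVec i) * β (Fin.cons (basisVec i) w) := by
  rw [contract0, map_sum, ContinuousAlternatingMap.sum_apply]
  refine Finset.sum_congr rfl fun i _ => ?_
  rw [map_smul]
  rfl

/-- Contraction with the Hodge dual is the Hodge dual of the wedge product. -/
theorem contract0_hodge0 (a : E7 [⋀^Fin 1]→L[ℝ] ℝ) (α : E7 [⋀^Fin 3]→L[ℝ] ℝ) :
    contract0 a (hodge0 (k := 3) (q := 3 + 1) rfl α) =
      hodge0 (k := 3 + 1) (q := 3) rfl (wedge α a) := by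
  ext w
  rw [contract0_apply, hodge0_wedge]
  simp only [hodge0_apply, sum_tuple_one]
  rw [Finset.sum_comm, Finset.mul_sum]
  refine Finset.sum_congr rfl fun i _ => ?_
  simp only [Finset.mul_sum]
  refine Finset.sum_congr rfl fun I _ => ?_
  have : volAppend (k := 3) (q := 3 + 1) rfl (basisTuple I) (Fin.cons (basisVec i) w) =
      volAppend (k := 3 + 1) (q := 3) rfl
        (Fin.append (basisTuple I) (basisTuple fun _ : Fin 1 => i)) w := by
    unfold volAppend
    congr 1
    funext m
    fin_cases m <;> rfl
  have ha : a (fun _ => basisVec i) = a (basisTuple fun _ => i) := rfl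
  rw [this, ha]
  simp [Nat.factorial]
  ring

/-- Moving one vector past three others takes three transpositions, hence the sign. -/
theorem wedge_three_one (α : E7 [⋀^Fin 3]→L[ℝ] ℝ) (a : E7 [⋀^Fin 1]→L[ℝ] ℝ) :
    (wedge α a : E7 [⋀^Fin 4]→L[ℝ] ℝ) = -(wedge a α : E7 [⋀^Fin 4]→L[ℝ] ℝ) := by
  apply hodge0_injective (k := 4) (q := 3) rfl
  rw [← neg_one_smul ℝ (wedge a α : E7 [⋀^Fin 4]→L[ℝ] ℝ), hodge0_smul]
  ext w
  have h1 := hodge0_wedge (q := 3) rfl α a w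
  have h2 := hodge0_wedge (q := 3) rfl a α w
  refine h1.trans ?_
  rw [ContinuousAlternatingMap.smul_apply]
  refine Eq.trans ?_ (congrArg (fun t => (-1 : ℝ) • t) h2.symm)
  rw [Finset.sum_comm, smul_eq_mul, mul_left_comm, mul_comm (3 ! : ℝ)]
  refine congrArg (((1 ! : ℝ) * (3 ! : ℝ))⁻¹ * ·) ?_
  rw [Finset.mul_sum]
  refine Finset.sum_congr rfl fun J _ => ?_
  rw [Finset.mul_sum]
  refine Finset.sum_congr rfl fun I _ => ?_
  have : volAppend (k := 3 + 1) (q := 3) rfl (Fin.append (basisTuple I) (basisTuple J)) w =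
      -volAppend (k := 1 + 3) (q := 3) rfl (Fin.append (basisTuple J) (basisTuple I)) w := by
    have := vol0_eq_of_perm (Equiv.swap 0 1 * Equiv.swap 1 2 * Equiv.swap 2 3)
      (v := fun m => Fin.append (Fin.append (basisTuple J) (basisTuple I)) w m)
      (v' := fun m => Fin.append (Fin.append (basisTuple I) (basisTuple J)) w m)
      (by intro m; fin_cases m <;> rfl)
    refine this.trans ?_
    simp only [Equiv.Perm.sign_mul]
    rw [Equiv.Perm.sign_swap (by decide), Equiv.Perm.sign_swap (by decide),
      Equiv.Perm.sign_swap (by decide)]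
    simp [volAppend]
  rw [this]
  ring

theorem volAppend_three_three (u v : Fin 3 → E7) (w : Fin 1 → E7) :
    volAppend (k := 3 + 3) (q := 1) rfl (Fin.append u v) w =
      -volAppend (k := 3 + 3) (q := 1) rfl (Fin.append v u) w := by
  refine (vol0_eq_of_perm (Equiv.swap 0 3 * Equiv.swap 1 4 * Equiv.swap 2 5)
      (v := fun m => Fin.append (Fin.append v u) w m)
      (by intro m; fin_cases m <;> rfl)).trans ?_
  simp only [Equiv.Perm.sign_mul]
  rw [Equiv.Perm.sign_swap (by decide), Equiv.Perm.sign_swap (by decide),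
    Equiv.Perm.sign_swap (by decide)]
  simp [volAppend]

/-- Exchanging two blocks of three vectors is an odd permutation, so the double sum of volumes
equals its own negative. -/
theorem wedge_self_three (α : E7 [⋀^Fin 3]→L[ℝ] ℝ) : wedge α α = 0 := by
  apply hodge0_injective (k := 3 + 3) (q := 1) rfl
  ext w
  rw [hodge0_wedge, hodge0_zero]
  refine mul_eq_zero_of_right _ ?_
  rw [← self_eq_neg, ← Finset.sum_neg_distrib]
  conv_lhs => rw [Finset.sum_comm]
  refine Finset.sum_congr rfl fun I _ => ?_
  rw [← Finset.sum_neg_distrib]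
  refine Finset.sum_congr rfl fun J _ => ?_
  rw [volAppend_three_three]
  ring

/-- Both sides have star `⟨α, β⟩`, which is symmetric. For `β = φ` this merges the two orthogonality
conditions on `Hp` into one. -/
theorem star_wedge_eq (α β : E7 [⋀^Fin 3]→L[ℝ] ℝ) :
    (wedge (hodge0 (k := 3) (q := 4) rfl α) β : E7 [⋀^Fin 7]→L[ℝ] ℝ) =
      (wedge α (hodge0 (k := 3) (q := 4) rfl β) : E7 [⋀^Fin 7]→L[ℝ] ℝ) := by
  refine hodge0_injective (k := 7) (q := 0) rfl ?_
  have h1 := hodge0_hodge0_wedge (k := 3) (q := 4) rfl rfl β α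
  have h2 := hodge0_wedge_hodge0 (k := 3) (q := 4) rfl rfl α β
  rw [formInner_comm] at h1
  exact h1.trans h2.symm

theorem wedge_star_eq (α β : E7 [⋀^Fin 3]→L[ℝ] ℝ) :
    (wedge β (hodge0 (k := 3) (q := 4) rfl α) : E7 [⋀^Fin 7]→L[ℝ] ℝ) =
      (wedge α (hodge0 (k := 3) (q := 4) rfl β) : E7 [⋀^Fin 7]→L[ℝ] ℝ) := by
  refine hodge0_injective (k := 7) (q := 0) rfl ?_
  have h1 := hodge0_wedge_hodge0 (k := 3) (q := 4) rfl rfl β α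
  have h2 := hodge0_wedge_hodge0 (k := 3) (q := 4) rfl rfl α β
  rw [formInner_comm] at h1
  exact h1.trans h2.symm

/-- By `contract0_hodge0` the contraction is `*(α ∧ a)`; the star undoes itself and the sign comes
from reordering. -/
theorem hodge0_contract0_hodge0 (a : E7 [⋀^Fin 1]→L[ℝ] ℝ) (α : E7 [⋀^Fin 3]→L[ℝ] ℝ) :
    hodge0 (k := 3) (q := 4) rfl (contract0 a (hodge0 (k := 3) (q := 3 + 1) rfl α)) =
      -(wedge a α : E7 [⋀^Fin 4]→L[ℝ] ℝ) := by
  rw [contract0_hodge0, ← wedge_three_one]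
  exact hodge0_hodge0 (k := 3 + 1) (q := 3) rfl rfl (wedge α a)

/-- A three-form is orthogonal to every contraction of its Hodge dual. -/
theorem formInner_contract0_hodge0 (a : E7 [⋀^Fin 1]→L[ℝ] ℝ) (α : E7 [⋀^Fin 3]→L[ℝ] ℝ) :
    formInner (contract0 a (hodge0 (k := 3) (q := 3 + 1) rfl α)) α = 0 := by
  have hv : ∀ u v : Fin 3 → E7, ∀ x : E7,
      volAppend (k := 3) (q := 3 + 1) rfl u (Fin.cons x v) =
        -volAppend (k := 3) (q := 3 + 1) rfl v (Fin.cons x u) := by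
    intro u v x
    refine (vol0_eq_of_perm (Equiv.swap 0 4 * Equiv.swap 1 5 * Equiv.swap 2 6)
        (v := fun m => Fin.append v (Fin.cons x u : Fin (3 + 1) → E7) m)
        (by intro m; fin_cases m <;> rfl)).trans ?_
    simp only [Equiv.Perm.sign_mul]
    rw [Equiv.Perm.sign_swap (by decide), Equiv.Perm.sign_swap (by decide),
      Equiv.Perm.sign_swap (by decide)]
    simp [volAppend]
  refine mul_eq_zero_of_right _ ?_
  simp only [contract0_apply, Finset.sum_mul]
  rw [Finset.sum_comm]
  refine Finset.sum_eq_zero fun i _ => ?_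
  simp only [hodge0_apply, Finset.mul_sum, Finset.sum_mul]
  rw [← self_eq_neg, ← Finset.sum_neg_distrib]
  conv_lhs => rw [Finset.sum_comm]
  refine Finset.sum_congr rfl fun I _ => ?_
  rw [← Finset.sum_neg_distrib]
  refine Finset.sum_congr rfl fun J _ => ?_
  rw [hv]
  ring

/-- Since `a ∧ α = -*(a ⌟ *α)`, the product is a multiple of the inner product of `α` with `a ⌟ *α`,
which vanishes. No associativity of the wedge is needed. -/
theorem wedge_wedge_self_three (a : E7 [⋀^Fin 1]→L[ℝ] ℝ) (α : E7 [⋀^Fin 3]→L[ℝ] ℝ) :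
    (wedge α (wedge a α : E7 [⋀^Fin 4]→L[ℝ] ℝ) : E7 [⋀^Fin 7]→L[ℝ] ℝ) = 0 := by
  have h : (wedge a α : E7 [⋀^Fin 4]→L[ℝ] ℝ) =
      (-1 : ℝ) • hodge0 (k := 3) (q := 4) rfl
        (contract0 a (hodge0 (k := 3) (q := 3 + 1) rfl α)) := by
    rw [hodge0_contract0_hodge0]; simp
  rw [h, wedge_smul_right]
  refine smul_eq_zero_of_right _ (hodge0_injective (k := 7) (q := 0) rfl ?_)
  have h1 := hodge0_wedge_hodge0 (k := 3) (q := 4) rfl rfl α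
    (contract0 a (hodge0 (k := 3) (q := 3 + 1) rfl α))
  rw [formInner_comm, formInner_contract0_hodge0] at h1
  refine h1.trans ?_
  rw [hodge0_zero]
  ext
  rfl

/-! ### Components of the standard `G₂` forms -/

/-- The Kronecker delta. -/
def delta (a b : Fin 7) : ℤ := bif a.val.beq b.val then 1 else 0

/-- The components `e^{ijk}(e_a, e_b, e_c)` of a monomial three-form. -/
def deltaThree (i j k a b c : Fin 7) : ℤ :=
  (delta a i * delta b j - delta a j * delta b i) * delta c k +
    (delta b i * delta c j - delta b j * delta c i) * delta a k +
      (delta c i * delta a j - delta c j * delta a i) * delta b k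

/-- The components of the standard three-form: `φ_{abc}` vanishes unless the labels
`a + 1`, `b + 1`, `c + 1` are the nonzero elements of a subgroup of `(ℤ/2)³`, and the bits of the
numeral record the positive ones among the products of two octonion units. -/
def phiCoeff (a b c : Fin 7) : ℤ :=
  bif ((a.val + 1).xor (b.val + 1)).beq (c.val + 1) then
    (bif Nat.testBit 112770651022890 (7 * a.val + b.val) then 1 else -1) else 0

/-- The components of the standard four-form. -/
def psiCoeff (a b c d : Fin 7) : ℤ :=
  bif (((a.val + 1).xor (b.val + 1)).xor ((c.val + 1).xor (d.val + 1))).beq 0 then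
    delta a d * delta b c - delta a c * delta b d + ∑ m, phiCoeff a b m * phiCoeff m c d
  else 0

/-- The Vandermonde product of a list of integers. -/
def vandermondeProd : List ℤ → ℤ
  | [] => 1
  | x :: l => l.foldl (fun r y => r * (y - x)) (vandermondeProd l)

/-- A finite check; keeping the components integral makes it, and the contractions that follow,
decidable by evaluation. -/
theorem deltaThree_sum : ∀ a b c : Fin 7,
    deltaThree 0 1 2 a b c + deltaThree 0 3 4 a b c + deltaThree 0 5 6 a b c +
      deltaThree 1 3 5 a b c - deltaThree 1 4 6 a b c - deltaThree 2 3 6 a b c -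
      deltaThree 2 4 5 a b c = phiCoeff a b c := by
  decide +kernel

theorem sum_phiCoeff_mul_phiCoeff : ∀ a b : Fin 7,
    ∑ i, ∑ j, phiCoeff a i j * phiCoeff b i j = 6 * delta a b := by
  decide +kernel

theorem sum_phiCoeff_mul_psiCoeff : ∀ a k l : Fin 7,
    ∑ i, ∑ j, phiCoeff a i j * psiCoeff i j k l = 4 * phiCoeff a k l := by
  decide +kernel

theorem sum_psiCoeff_mul_psiCoeff : ∀ a b : Fin 7,
    ∑ i, ∑ j, ∑ k, psiCoeff a i j k * psiCoeff b i j k = 24 * delta a b := by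
  decide +kernel

/-- The constant is `1! 2! 3! 4! 5! 6!`, the Vandermonde product of `0, …, 6`. A tuple of labels has
this product times its sign, or zero if a label repeats, so the left side lists the components of
`*φ`. It also confirms the contraction formula by which `psiCoeff` is defined. -/
theorem vandermondeProd_sum : ∀ a b c d : Fin 7,
    vandermondeProd [0, 1, 2, a.val, b.val, c.val, d.val] +
      vandermondeProd [0, 3, 4, a.val, b.val, c.val, d.val] +
      vandermondeProd [0, 5, 6, a.val, b.val, c.val, d.val] +
      vandermondeProd [1, 3, 5, a.val, b.val, c.val, d.val] -
      vandermondeProd [1, 4, 6, a.val, b.val, c.val, d.val] -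
      vandermondeProd [2, 3, 6, a.val, b.val, c.val, d.val] -
      vandermondeProd [2, 4, 5, a.val, b.val, c.val, d.val] = 24883200 * psiCoeff a b c d := by
  decide +kernel

theorem sum_perm_two {M : Type*} [AddCommMonoid M] (F : Equiv.Perm (Fin 2) → M) :
    ∑ σ, F σ = F 1 + F (Equiv.swap 0 1) := by
  rw [show (Finset.univ : Finset (Equiv.Perm (Fin 2))) = {1, Equiv.swap 0 1} by decide,
    Finset.sum_pair (by decide)]

theorem sum_perm_three {M : Type*} [AddCommMonoid M] (F : Equiv.Perm (Fin 3) → M) :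
    ∑ σ, F σ = F 1 + (F (Equiv.swap 0 1) + (F (Equiv.swap 0 2) + (F (Equiv.swap 1 2) +
      (F (Equiv.swap 0 1 * Equiv.swap 1 2) + F (Equiv.swap 1 2 * Equiv.swap 0 1))))) := by
  rw [show (Finset.univ : Finset (Equiv.Perm (Fin 3))) = {1, Equiv.swap 0 1, Equiv.swap 0 2,
    Equiv.swap 1 2, Equiv.swap 0 1 * Equiv.swap 1 2, Equiv.swap 1 2 * Equiv.swap 0 1} by decide,
    Finset.sum_insert (by decide), Finset.sum_insert (by decide), Finset.sum_insert (by decide),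
    Finset.sum_insert (by decide), Finset.sum_pair (by decide)]

theorem dx_apply (i : Fin 7) (v : Fin 1 → E7) : dx i v = v 0 i := rfl

theorem wedge_dx_dx_apply (i j : Fin 7) (v : Fin 2 → E7) :
    (wedge (dx i) (dx j) : E7 [⋀^Fin 2]→L[ℝ] ℝ) v = v 0 i * v 1 j - v 0 j * v 1 i := by
  refine (wedge_apply (dx i) (dx j) v).trans ?_
  rw [sum_perm_two]
  simp only [dx_apply]
  have h0 : Fin.castAdd 1 (0 : Fin 1) = (0 : Fin 2) := rfl
  have h1 : Fin.natAdd 1 (0 : Fin 1) = (1 : Fin 2) := rfl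
  rw [h0, h1, Equiv.Perm.sign_swap (by decide)]
  simp
  ring

theorem dx3_apply (i j k : Fin 7) (v : Fin 3 → E7) :
    dx3 i j k v = (v 0 i * v 1 j - v 0 j * v 1 i) * v 2 k +
      (v 1 i * v 2 j - v 1 j * v 2 i) * v 0 k +
      (v 2 i * v 0 j - v 2 j * v 0 i) * v 1 k := by
  refine (wedge_apply (wedge (dx i) (dx j) : E7 [⋀^Fin 2]→L[ℝ] ℝ) (dx k) v).trans ?_
  rw [sum_perm_three]
  simp only [wedge_dx_dx_apply, dx_apply]
  have h0 : Fin.castAdd 1 (0 : Fin 2) = (0 : Fin 3) := rfl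
  have h1 : Fin.castAdd 1 (1 : Fin 2) = (1 : Fin 3) := rfl
  have h2 : Fin.natAdd 2 (0 : Fin 1) = (2 : Fin 3) := rfl
  simp only [h0, h1, h2, Equiv.Perm.sign_mul]
  rw [Equiv.Perm.sign_swap (by decide), Equiv.Perm.sign_swap (by decide),
    Equiv.Perm.sign_swap (by decide)]
  have e1 : (Equiv.swap (0 : Fin 3) 1) 2 = 2 := by decide
  have e2 : (Equiv.swap (0 : Fin 3) 2) 1 = 1 := by decide
  have e3 : (Equiv.swap (1 : Fin 3) 2) 0 = 0 := by decide
  simp [e1, e2, e3, Nat.factorial]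
  ring

theorem basisVec_apply (i j : Fin 7) : basisVec i j = (delta i j : ℝ) := by
  by_cases h : i = j
  · subst h; simp [basisVec, delta]
  · have h' : i.val.beq j.val = false := by
      rw [← Bool.not_eq_true, Nat.beq_eq]
      simpa [Fin.ext_iff] using h
    simp only [delta, h']
    simp [basisVec, Ne.symm h]

theorem phi0_basis (a b c : Fin 7) :
    phi0 (basisTuple ![a, b, c]) = (phiCoeff a b c : ℝ) := by
  rw [← deltaThree_sum]
  simp only [phi0, ContinuousAlternatingMap.add_apply, ContinuousAlternatingMap.sub_apply,
    dx3_apply, basisTuple, Matrix.cons_val, basisVec_apply, deltaThree]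
  push_cast
  ring

/-- The nonzero components of `e^{ijk}` give six signed rearrangements of one volume, cancelling
`3!`. -/
theorem hodge0_dx3 (i j k : Fin 7) (w : Fin 4 → E7) :
    hodge0 (k := 3) (q := 4) rfl (dx3 i j k) w =
      volAppend (k := 3) (q := 4) rfl (basisTuple ![i, j, k]) w := by
  have hp : ∀ σ : Equiv.Perm (Fin 3),
      volAppend (k := 3) (q := 4) rfl (basisTuple (![i, j, k] ∘ σ)) w = Equiv.Perm.sign σ *
        volAppend (k := 3) (q := 4) rfl (basisTuple ![i, j, k]) w := fun σ =>
    volAppend_comp_perm (k := 3) (q := 4) rfl (basisTuple ![i, j, k]) w σ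
  have e1 : ![j, i, k] = ![i, j, k] ∘ Equiv.swap 0 1 := by
    funext m; fin_cases m <;> rfl
  have e2 : ![k, j, i] = ![i, j, k] ∘ Equiv.swap 0 2 := by
    funext m; fin_cases m <;> rfl
  have e3 : ![i, k, j] = ![i, j, k] ∘ Equiv.swap 1 2 := by
    funext m; fin_cases m <;> rfl
  have e4 : ![j, k, i] = ![i, j, k] ∘ (Equiv.swap 0 1 * Equiv.swap 1 2 : Equiv.Perm (Fin 3)) := by
    funext m; fin_cases m <;> rfl
  have e5 : ![k, i, j] = ![i, j, k] ∘ (Equiv.swap 1 2 * Equiv.swap 0 1 : Equiv.Perm (Fin 3)) := by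
    funext m; fin_cases m <;> rfl
  rw [hodge0_apply, sum_tuple_three]
  simp only [dx3_apply, basisTuple, Matrix.cons_val, basisVec, PiLp.single_apply]
  change _ * ∑ a, ∑ b, ∑ c, _ * volAppend _ (basisTuple ![a, b, c]) w = _
  -- With the volume an opaque function of the tuple, the sums over Kronecker deltas collapse to its
  -- values at the six rearrangements.
  generalize hV : (fun I => volAppend (k := 3) (q := 4) rfl (basisTuple I) w) = V
  have hV' : ∀ I, volAppend (k := 3) (q := 4) rfl (basisTuple I) w = V I := fun I => by rw [← hV]
  simp only [hV'] at hp ⊢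
  simp only [add_mul, sub_mul, Finset.sum_add_distrib, Finset.sum_sub_distrib, ite_mul, mul_ite,
    mul_one, mul_zero, one_mul, zero_mul, Finset.sum_ite_eq, Finset.mem_univ,
    if_true, Finset.sum_const_zero, Finset.sum_ite_irrel]
  rw [e1, e2, e3, e4, e5]
  simp only [hp, Equiv.Perm.sign_mul]
  rw [Equiv.Perm.sign_swap (by decide), Equiv.Perm.sign_swap (by decide),
    Equiv.Perm.sign_swap (by decide)]
  simp [Nat.factorial]
  ring

/-- Selecting rows of the Vandermonde matrix of `0, …, 6` is multiplication by the matrix of the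
basis tuple. Taking determinants replaces the volume by a product of integers. -/
theorem vol0_basis_vandermonde (a b c d e f g : Fin 7) :
    24883200 * vol0 (basisTuple ![a, b, c, d, e, f, g]) = (vandermondeProd
      [a.val, b.val, c.val, d.val, e.val, f.val, g.val] : ℝ) := by
  have h := Matrix.det_vandermonde
    (![a.val, b.val, c.val, d.val, e.val, f.val, g.val] : Fin 7 → ℝ)
  have hm : Matrix.vandermonde (![a.val, b.val, c.val, d.val, e.val, f.val, g.val] : Fin 7 → ℝ) =
      (Matrix.of fun i j => basisTuple ![a, b, c, d, e, f, g] i j) *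
        Matrix.vandermonde (fun a : Fin 7 => (a.val : ℝ)) := by
    ext i j
    have : (![a.val, b.val, c.val, d.val, e.val, f.val, g.val] : Fin 7 → ℝ) i =
        ((![a, b, c, d, e, f, g] i).val : ℝ) := by
      fin_cases i <;> rfl
    rw [Matrix.vandermonde_apply, this]
    simp [Matrix.mul_apply, Matrix.vandermonde, basisTuple, basisVec]
  rw [hm, Matrix.det_mul, Matrix.det_vandermonde] at h
  simp only [Fin.prod_univ_succ, Fin.prod_Ioi_succ, Fin.prod_Ioi_zero] at h
  simp at h
  simp only [vandermondeProd, List.foldl, vol0]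
  push_cast
  rw [one_mul, mul_comm]
  refine Eq.trans ?_ (h.trans ?_)
  · norm_num
  · ac_rfl

theorem psi0_basis (a b c d : Fin 7) :
    hodge0 (k := 3) (q := 4) rfl phi0 (basisTuple ![a, b, c, d]) = (psiCoeff a b c d : ℝ) := by
  have hv : ∀ i j k : Fin 7, 24883200 * hodge0 (k := 3) (q := 4) rfl (dx3 i j k)
      (basisTuple ![a, b, c, d]) = (vandermondeProd
      [i.val, j.val, k.val, a.val, b.val, c.val, d.val] : ℝ) := by
    intro i j k
    rw [hodge0_dx3]
    refine Eq.trans ?_ (vol0_basis_vandermonde i j k a b c d)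
    refine congrArg (24883200 * vol0 ·) ?_
    funext m
    fin_cases m <;> rfl
  have h := congrArg (Int.cast (R := ℝ)) (vandermondeProd_sum a b c d)
  push_cast at h
  simp only [phi0, hodge0_add, hodge0_sub]
  simp only [ContinuousAlternatingMap.add_apply, ContinuousAlternatingMap.sub_apply]
  have h1 := hv 0 1 2
  have h2 := hv 0 3 4
  have h3 := hv 0 5 6
  have h4 := hv 1 3 5
  have h5 := hv 1 4 6
  have h6 := hv 2 3 6
  have h7 := hv 2 4 5
  norm_num [Fin.ext_iff] at h1 h2 h3 h4 h5 h6 h7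
  linear_combination (1 / 24883200) * (h1 + h2 + h3 + h4 - h5 - h6 - h7 + h)

/-! ### Pointwise identities of the standard `G₂` structure -/

/-- The standard four-form. -/
noncomputable def psi0 : E7 [⋀^Fin 4]→L[ℝ] ℝ := hodge0 (k := 3) (q := 4) rfl phi0

theorem formInner_phi0 : formInner phi0 phi0 = 7 := by
  rw [formInner, sum_tuple_three]
  simp only [phi0_basis]
  -- Trace of the contraction `φ_{aij} φ_{bij} = 6 δ_{ab}`, so `42 = 6 · 7`; dividing by `3!` leaves
  -- `7`.
  have h : ∑ a : Fin 7, ∑ i, ∑ j, phiCoeff a i j * phiCoeff a i j = 42 := by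
    simp only [sum_phiCoeff_mul_phiCoeff]
    decide
  have h' := congrArg (Int.cast (R := ℝ)) h
  push_cast at h'
  rw [h']
  norm_num [Nat.factorial]

theorem phi0_wedge_psi0 : (wedge phi0 psi0 : E7 [⋀^Fin 7]→L[ℝ] ℝ) =
    (7 : ℝ) • hodge0 (k := 0) (q := 7) rfl
      (ContinuousAlternatingMap.constOfIsEmpty ℝ E7 (Fin 0) 1) := by
  refine hodge0_injective (k := 7) (q := 0) rfl ?_
  have h1 := hodge0_wedge_hodge0 (k := 3) (q := 4) rfl rfl phi0 phi0
  refine h1.trans ?_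
  rw [hodge0_smul, hodge0_hodge0, formInner_phi0]
  ext w
  simp

theorem sum_psi0_mul_psi0 (i j : Fin 7) :
    ∑ I : Fin 3 → Fin 7, psi0 (Fin.cons (basisVec i) (basisTuple I)) *
      psi0 (Fin.cons (basisVec j) (basisTuple I)) = 24 * delta i j := by
  have hc : ∀ i a b c : Fin 7, psi0 (Fin.cons (basisVec i) (basisTuple ![a, b, c])) =
      (psiCoeff i a b c : ℝ) := by
    intro i a b c
    rw [← psi0_basis, psi0]
    congr 1
    funext m
    fin_cases m <;> rfl
  rw [sum_tuple_three]
  simp only [hc]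
  exact_mod_cast sum_psiCoeff_mul_psiCoeff i j

/-- After a star, summing `φ` against the volume rebuilds `3! ψ`, so the coefficients become
`ψ_{iabc} ψ_{jabc} = 24 δ_{ij}`. The factor is `6 · 24 / (3! 3!) = 4`. -/
theorem contract0_psi0_wedge_phi0 (a : E7 [⋀^Fin 1]→L[ℝ] ℝ) :
    (wedge (contract0 a (k := 3) psi0) phi0 : E7 [⋀^Fin 6]→L[ℝ] ℝ) =
      (4 : ℝ) • hodge0 (k := 1) (q := 6) rfl a := by
  refine hodge0_injective (k := 6) (q := 1) rfl ?_
  rw [hodge0_smul, hodge0_hodge0]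
  have hw : ∀ (I : Fin 3 → Fin 7) (j : Fin 7), ∑ J : Fin 3 → Fin 7, phi0 (basisTuple J) *
      volAppend (k := 3 + 3) (q := 1) rfl (Fin.append (basisTuple I) (basisTuple J))
        (fun _ => basisVec j) = 6 * psi0 (Fin.cons (basisVec j) (basisTuple I)) := by
    intro I j
    rw [psi0, hodge0_apply]
    simp only [Finset.mul_sum]
    refine Finset.sum_congr rfl fun J _ => ?_
    have : volAppend (k := 3 + 3) (q := 1) rfl (Fin.append (basisTuple I) (basisTuple J))
        (fun _ => basisVec j) = volAppend (k := 3) (q := 4) rfl (basisTuple J)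
          (Fin.cons (basisVec j) (basisTuple I) : Fin (3 + 1) → E7) := by
      -- A rotation of seven slots is even, so this reordering costs no sign.
      refine (vol0_eq_of_perm (finRotate 7 ^ 4)
        (v := fun m => Fin.append (basisTuple J)
          (Fin.cons (basisVec j) (basisTuple I) : Fin (3 + 1) → E7) m)
        (by intro m; fin_cases m <;> rfl)).trans ?_
      rw [map_pow, sign_finRotate]
      simp [volAppend]
    rw [this]
    norm_num [Nat.factorial]
    ring
  have h := hodge0_wedge (k := 3) (l := 3) (q := 1) rfl (contract0 a (k := 3) psi0) phi0
  refine Eq.trans (b := hodge0 (k := 3 + 3) (q := 1) rfl (wedge (contract0 a (k := 3) psi0) phi0))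
    rfl ?_
  refine ext_basisTuple fun K _ => ?_
  rw [h]
  obtain ⟨j, rfl⟩ : ∃ j, K = fun _ => j := ⟨K 0, by funext m; rw [Subsingleton.elim m 0]⟩
  have hI : ∀ I : Fin 3 → Fin 7, ∑ J : Fin 3 → Fin 7,
      contract0 a (k := 3) psi0 (basisTuple I) * phi0 (basisTuple J) *
        volAppend (k := 3 + 3) (q := 1) rfl (Fin.append (basisTuple I) (basisTuple J))
          (basisTuple fun _ => j) =
      6 * ∑ i, a (fun _ => basisVec i) * (psi0 (Fin.cons (basisVec i) (basisTuple I)) *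
        psi0 (Fin.cons (basisVec j) (basisTuple I))) := by
    intro I
    simp only [mul_assoc]
    rw [← Finset.mul_sum]
    refine (congrArg _ (hw I j)).trans ?_
    rw [contract0_apply, Finset.sum_mul, Finset.mul_sum]
    exact Finset.sum_congr rfl fun i _ => by ring
  rw [Finset.sum_congr rfl fun I _ => hI I, ← Finset.mul_sum, Finset.sum_comm]
  simp only [← Finset.mul_sum, sum_psi0_mul_psi0, ContinuousAlternatingMap.smul_apply, smul_eq_mul]
  have hd : ∀ i, (delta i j : ℝ) = if i = j then 1 else 0 := by
    intro i
    rw [← basisVec_apply]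
    simp [basisVec, eq_comm]
  simp only [hd]
  simp [Nat.factorial]
  change _ = 4 * a fun _ => basisVec j
  ring

/-! ### Identities of forms on a manifold with a `G₂` structure -/

section Forms

variable {Y : Type*} [TopologicalSpace Y] [ChartedSpace E7 Y]

theorem fwedge_add_left {k l : ℕ} (α α' : Form Y k) (β : Form Y l) :
    fwedge (α + α') β = fwedge α β + fwedge α' β :=
  funext fun x => wedge_add_left (α x) (α' x) (β x)

theorem fwedge_add_right {k l : ℕ} (α : Form Y k) (β β' : Form Y l) :
    fwedge α (β + β') = fwedge α β + fwedge α β' :=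
  funext fun x => wedge_add_right (α x) (β x) (β' x)

theorem fwedge_smul_left {k l : ℕ} (c : ℝ) (α : Form Y k) (β : Form Y l) :
    fwedge (c • α) β = c • fwedge α β :=
  funext fun x => wedge_smul_left c (α x) (β x)

theorem fwedge_smul_right {k l : ℕ} (c : ℝ) (α : Form Y k) (β : Form Y l) :
    fwedge α (c • β) = c • fwedge α β :=
  funext fun x => wedge_smul_right c (α x) (β x)

theorem fwedge_fmul_left {k l : ℕ} (f : Y → ℝ) (α : Form Y k) (β : Form Y l) :
    fwedge (fmul f α) β = fmul f (fwedge α β) :=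
  funext fun x => wedge_smul_left (f x) (α x) (β x)

theorem fwedge_neg_left {k l : ℕ} (α : Form Y k) (β : Form Y l) :
    fwedge (-α) β = -fwedge α β := by
  rw [← neg_one_smul ℝ α, fwedge_smul_left]
  exact neg_one_smul ℝ (fwedge α β)

theorem fwedge_neg_right {k l : ℕ} (α : Form Y k) (β : Form Y l) :
    fwedge α (-β) = -fwedge α β := by
  rw [← neg_one_smul ℝ β, fwedge_smul_right]
  exact neg_one_smul ℝ (fwedge α β)

end Forms

namespace G2Structure

variable {Y : Type*} [TopologicalSpace Y] [ChartedSpace E7 Y] (G : G2Structure Y)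

/-- The expression of a form at `x` in the adapted frame. -/
noncomputable def inFrame {k : ℕ} (α : Form Y k) (x : Y) : E7 [⋀^Fin k]→L[ℝ] ℝ :=
  (α x).compContinuousLinearMap ((G.frame x).symm : E7 →L[ℝ] TangentSpace (𝓡 7) x)

/-- Frames are invertible, so identities of forms can be verified on `ℝ⁷` with the standard `φ` and
`ψ`. -/
theorem inFrame_injective {k : ℕ} {α β : Form Y k} (h : ∀ x, G.inFrame α x = G.inFrame β x) :
    α = β := by
  funext x
  ext v
  have := congrArg (fun θ => θ fun i => G.frame x (v i)) (h x)
  simpa [inFrame, Function.comp_def] using this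

theorem form_apply (x : Y) : G.form x =
    phi0.compContinuousLinearMap (G.frame x : TangentSpace (𝓡 7) x →L[ℝ] E7) :=
  (G.positive x).choose_spec

theorem comp_frame_comp_frame_symm {k : ℕ} (x : Y) (θ : E7 [⋀^Fin k]→L[ℝ] ℝ) :
    (θ.compContinuousLinearMap
      (G.frame x : TangentSpace (𝓡 7) x →L[ℝ] E7)).compContinuousLinearMap
        ((G.frame x).symm : E7 →L[ℝ] TangentSpace (𝓡 7) x) = θ := by
  ext v
  simp [Function.comp_def]

theorem inFrame_form (x : Y) : G.inFrame G.form x = phi0 := by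
  rw [inFrame, form_apply, comp_frame_comp_frame_symm]

theorem inFrame_hodge {k q : ℕ} (h : k + q = 7) (α : Form Y k) (x : Y) :
    G.inFrame (G.hodge h α) x = hodge0 h (G.inFrame α x) :=
  G.comp_frame_comp_frame_symm x _

theorem inFrame_contract {k : ℕ} (a : Form Y 1) (β : Form Y (k + 1)) (x : Y) :
    G.inFrame (G.contract a β) x = contract0 (G.inFrame a x) (G.inFrame β x) :=
  G.comp_frame_comp_frame_symm x _

theorem inFrame_psi (x : Y) : G.inFrame G.psi x = psi0 := by
  rw [psi, inFrame_hodge, inFrame_form, psi0]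

theorem psi_apply (x : Y) : G.psi x =
    psi0.compContinuousLinearMap (G.frame x : TangentSpace (𝓡 7) x →L[ℝ] E7) := by
  rw [psi0, ← G.inFrame_form x]
  rfl

theorem inFrame_fwedge {k l : ℕ} (α : Form Y k) (β : Form Y l) (x : Y) :
    G.inFrame (fwedge α β) x = wedge (G.inFrame α x) (G.inFrame β x) :=
  wedge_compContinuousLinearMap _ _ _

theorem hodge_add {k q : ℕ} (h : k + q = 7) (α β : Form Y k) :
    G.hodge h (α + β) = G.hodge h α + G.hodge h β := by
  funext x
  exact congrArg (fun θ => ContinuousAlternatingMap.compContinuousLinearMap θ _) <|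
    hodge0_add h (G.inFrame α x) (G.inFrame β x)

theorem hodge_fmul {k q : ℕ} (h : k + q = 7) (f : Y → ℝ) (α : Form Y k) :
    G.hodge h (fmul f α) = fmul f (G.hodge h α) := by
  funext x
  exact congrArg (fun θ => ContinuousAlternatingMap.compContinuousLinearMap θ _) <|
    hodge0_smul h (f x) (G.inFrame α x)

theorem hodge_smul {k q : ℕ} (h : k + q = 7) (c : ℝ) (α : Form Y k) :
    G.hodge h (c • α) = c • G.hodge h α :=
  G.hodge_fmul h (fun _ => c) α

theorem hodge_neg {k q : ℕ} (h : k + q = 7) (α : Form Y k) :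
    G.hodge h (-α) = -G.hodge h α := by
  rw [← neg_one_smul ℝ α, hodge_smul]
  exact neg_one_smul ℝ (G.hodge h α)

theorem star_fwedge_form (α : Form Y 3) :
    (fwedge (G.hodge (k := 3) (q := 4) rfl α) G.form : Form Y 7) =
      (fwedge α G.psi : Form Y 7) := by
  refine G.inFrame_injective fun x => ?_
  refine (G.inFrame_fwedge (G.hodge (k := 3) (q := 4) rfl α) G.form x).trans ?_
  refine Eq.trans ?_ (G.inFrame_fwedge α G.psi x).symm
  rw [inFrame_hodge, inFrame_form, inFrame_psi]
  exact star_wedge_eq _ _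

theorem form_fwedge_star (α : Form Y 3) :
    (fwedge G.form (G.hodge (k := 3) (q := 4) rfl α) : Form Y 7) =
      (fwedge α G.psi : Form Y 7) := by
  refine G.inFrame_injective fun x => ?_
  refine (G.inFrame_fwedge G.form (G.hodge (k := 3) (q := 4) rfl α) x).trans ?_
  refine Eq.trans ?_ (G.inFrame_fwedge α G.psi x).symm
  rw [inFrame_hodge, inFrame_form, inFrame_psi]
  exact wedge_star_eq _ _

theorem form_fwedge_psi :
    (fwedge G.form G.psi : Form Y 7) =
      (7 : ℝ) • G.hodge (k := 0) (q := 7) rfl (ofFun fun _ => 1) := by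
  rw [← hodge_smul]
  refine G.inFrame_injective fun x => ?_
  refine (G.inFrame_fwedge G.form G.psi x).trans ?_
  rw [inFrame_hodge, inFrame_form, inFrame_psi]
  refine phi0_wedge_psi0.trans ?_
  rw [← hodge0_smul]
  rfl

theorem hodge_ofFun (f : Y → ℝ) : G.hodge (k := 0) (q := 7) rfl (ofFun f) =
    fmul f (G.hodge (k := 0) (q := 7) rfl (ofFun fun _ => 1)) := by
  rw [← hodge_fmul]
  congr 1
  funext x
  ext v
  simp [ofFun, fmul]

theorem hodge_contract_psi (a : Form Y 1) :
    G.hodge (k := 3) (q := 4) rfl (G.contract a (k := 3) G.psi) =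
      -(fwedge a G.form : Form Y 4) := by
  rw [← fwedge_neg_left]
  refine G.inFrame_injective fun x => ?_
  refine Eq.trans ?_ (G.inFrame_fwedge (-a) G.form x).symm
  rw [inFrame_hodge, inFrame_form, inFrame_contract, inFrame_psi]
  refine (hodge0_contract0_hodge0 (G.inFrame a x) phi0).trans ?_
  have h : G.inFrame (-a) x = (-1 : ℝ) • G.inFrame a x := by
    exact (neg_one_smul ℝ (G.inFrame a x)).symm
  rw [h, wedge_smul_left]
  exact (neg_one_smul ℝ _).symm

theorem contract_psi_fwedge_form (a : Form Y 1) :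
    (fwedge (G.contract a (k := 3) G.psi) G.form : Form Y 6) =
      (4 : ℝ) • G.hodge (k := 1) (q := 6) rfl a := by
  rw [← hodge_smul]
  refine G.inFrame_injective fun x => ?_
  refine (G.inFrame_fwedge (G.contract a (k := 3) G.psi) G.form x).trans ?_
  rw [inFrame_hodge, inFrame_form, inFrame_contract, inFrame_psi]
  refine (contract0_psi0_wedge_phi0 (G.inFrame a x)).trans ?_
  rw [← hodge0_smul]
  rfl

theorem form_fwedge_form : (fwedge G.form G.form : Form Y 6) = 0 :=
  funext fun x => by
    change wedge (G.form x) (G.form x) = 0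
    rw [form_apply, ← wedge_compContinuousLinearMap, wedge_self_three]
    rfl

theorem form_fwedge_fwedge_form (a : Form Y 1) :
    (fwedge G.form (fwedge a G.form : Form Y 4) : Form Y 7) = 0 := by
  refine G.inFrame_injective fun x => ?_
  refine (G.inFrame_fwedge G.form (fwedge a G.form : Form Y 4) x).trans ?_
  refine (congrArg _ (G.inFrame_fwedge a G.form x)).trans ?_
  rw [inFrame_form]
  exact wedge_wedge_self_three _ _

end G2Structure

/-! ### The Killing spinor equations in terms of torsion classes -/

namespace G2Structure

variable {Y : Type*} [TopologicalSpace Y] [ChartedSpace E7 Y] (G : G2Structure Y)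

theorem fmul_const_mul {k : ℕ} (c : ℝ) (f : Y → ℝ) (α : Form Y k) :
    fmul (fun y => c * f y) α = c • fmul f α :=
  funext fun x => mul_smul c (f x) (α x)

theorem fmul_zero {k : ℕ} (f : Y → ℝ) : fmul f (0 : Form Y k) = 0 :=
  funext fun x => smul_zero (f x)

theorem fwedge_zero_left {k l : ℕ} (β : Form Y l) : fwedge (0 : Form Y k) β = 0 := by
  have h := fwedge_smul_left (0 : ℝ) (0 : Form Y k) β
  rw [zero_smul] at h
  exact h.trans (zero_smul ℝ (fwedge (0 : Form Y k) β))

theorem hodge_zero {k q : ℕ} (h : k + q = 7) : G.hodge h (0 : Form Y k) = 0 := by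
  have h' := G.hodge_smul h (0 : ℝ) (0 : Form Y k)
  rw [zero_smul] at h'
  exact h'.trans (zero_smul ℝ (G.hodge h (0 : Form Y k)))

/-- The flux `τ₃ = -Hp - ½ a ⌟ ψ` has `*τ₃ = -*Hp + ½ a ∧ φ`. -/
theorem hodge_torsion_three (a : Form Y 1) (Hp : Form Y 3) :
    G.hodge (k := 3) (q := 4) rfl (-Hp - (1 / 2 : ℝ) • G.contract a G.psi) =
      -G.hodge (k := 3) (q := 4) rfl Hp + (1 / 2 : ℝ) • (fwedge a G.form : Form Y 4) := by
  have h : -Hp - (1 / 2 : ℝ) • G.contract a G.psi =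
      -Hp + (-(1 / 2) : ℝ) • G.contract a (k := 3) G.psi := by
    module
  rw [h, hodge_add, hodge_neg, hodge_smul, hodge_contract_psi]
  module

theorem torsion_three_fwedge_form (a : Form Y 1) (Hp : Form Y 3) :
    (fwedge (-Hp - (1 / 2 : ℝ) • G.contract a G.psi) G.form : Form Y 6) =
      -(fwedge Hp G.form : Form Y 6) - (2 : ℝ) • G.hodge (k := 1) (q := 6) rfl a := by
  have h : -Hp - (1 / 2 : ℝ) • G.contract a G.psi =
      -Hp + (-(1 / 2) : ℝ) • G.contract a (k := 3) G.psi := by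
    module
  rw [h, fwedge_add_left, fwedge_neg_left, fwedge_smul_left, contract_psi_fwedge_form]
  module

theorem form_fwedge_hodge_torsion_three {Hp : Form Y 3} (a : Form Y 1)
    (hHp : (fwedge Hp G.psi : Form Y 7) = 0) :
    (fwedge G.form (G.hodge (k := 3) (q := 4) rfl
      (-Hp - (1 / 2 : ℝ) • G.contract a G.psi)) : Form Y 7) = 0 := by
  rw [hodge_torsion_three, fwedge_add_right, fwedge_neg_right, fwedge_smul_right]
  have key : ∀ X Z : Form Y 7, X = 0 → Z = 0 → -X + (1 / 2 : ℝ) • Z = 0 := by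
    rintro _ _ rfl rfl
    module
  exact key _ _ ((G.form_fwedge_star Hp).trans hHp) (G.form_fwedge_fwedge_form a)

theorem fwedge_form_of_decomposition {H Hp : Form Y 3} {f : Y → ℝ}
    (hH : H = fmul (fun y => 1 / 14 * f y) G.form + Hp) :
    (fwedge H G.form : Form Y 6) = fwedge Hp G.form := by
  rw [hH, fwedge_add_left, fwedge_fmul_left]
  have h : fmul (fun y => 1 / 14 * f y) (fwedge G.form G.form : Form Y 6) = 0 := by
    rw [form_fwedge_form, fmul_zero]
  exact (congrArg (· + (fwedge Hp G.form : Form Y 6)) h).trans (zero_add _)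

/-- The coefficient `1/14` is chosen so that `(1/14) φ ∧ ψ = ½ vol`; the equation for `*f` then
reduces to `Hp ∧ ψ = 0`. -/
theorem fwedge_psi_of_decomposition {H Hp : Form Y 3} {f : Y → ℝ}
    (hH : H = fmul (fun y => 1 / 14 * f y) G.form + Hp) :
    (fwedge H G.psi : Form Y 7) = (1 / 2 : ℝ) • G.hodge (k := 0) (q := 7) rfl (ofFun f) +
      (fwedge Hp G.psi : Form Y 7) := by
  rw [hH, fwedge_add_left, fwedge_fmul_left]
  refine congrArg (· + (fwedge Hp G.psi : Form Y 7)) ?_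
  refine (congrArg (fmul _) G.form_fwedge_psi).trans ?_
  rw [G.hodge_ofFun f]
  generalize G.hodge (k := 0) (q := 7) rfl (ofFun fun _ : Y => 1) = X
  funext x
  change (1 / 14 * f x) • (7 : ℝ) • X x = (1 / 2 : ℝ) • f x • X x
  module

theorem hodge_of_decomposition {H Hp : Form Y 3} {f : Y → ℝ}
    (hH : H = fmul (fun y => 1 / 14 * f y) G.form + Hp) :
    G.hodge (k := 3) (q := 4) rfl H = (1 / 14 : ℝ) • fmul f G.psi +
      G.hodge (k := 3) (q := 4) rfl Hp := by
  rw [hH, hodge_add, hodge_fmul, fmul_const_mul]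
  rfl

theorem killingSpinor_iff (ϕ f : Y → ℝ) (H : Form Y 3) :
    G.KillingSpinor ϕ H f ↔
      ∃ (Hp : Form Y 3) (τ₀ : Y → ℝ) (τ₁ : Form Y 1) (τ₂ : Form Y 2) (τ₃ : Form Y 3),
        G.IsFluxDecomposition H f Hp ∧ G.IsTorsion τ₀ τ₁ τ₂ τ₃ ∧
        (∀ y, τ₀ y = -(15 / 14) * f y) ∧
        τ₁ = (1 / 2 : ℝ) • dFun ϕ ∧
        τ₂ = 0 ∧
        τ₃ = -Hp - (1 / 2 : ℝ) • G.contract (dFun ϕ) G.psi ∧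
        G.hodge (k := 3) (q := 4) rfl τ₃ =
          -G.hodge (k := 3) (q := 4) rfl Hp
            + (1 / 2 : ℝ) • (fwedge (dFun ϕ) G.form : Form Y 4) := by
  constructor
  · intro hK
    obtain ⟨Hp, hHp⟩ : ∃ Hp, H = fmul (fun y => 1 / 14 * f y) G.form + Hp :=
      ⟨H - fmul (fun y => 1 / 14 * f y) G.form, by abel⟩
    have hpsi : (fwedge Hp G.psi : Form Y 7) = 0 := by
      have h := hK.star_f
      rw [G.fwedge_psi_of_decomposition hHp] at h
      exact left_eq_add.1 h
    have hst := G.star_fwedge_form Hp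
    rw [hpsi] at hst
    have hform : (fwedge Hp G.form : Form Y 6) =
        -((2 : ℝ) • G.hodge (k := 1) (q := 6) rfl (dFun ϕ)) := by
      rw [hK.star_d_dilaton, G.fwedge_form_of_decomposition hHp]
      module
    refine ⟨Hp, fun y => -(15 / 14) * f y, (1 / 2 : ℝ) • dFun ϕ, 0, _, ⟨hHp, hpsi, hst⟩, ?_,
      fun _ => rfl, rfl, rfl, rfl, G.hodge_torsion_three _ _⟩
    refine ⟨?_, ?_, fwedge_zero_left _, ?_, ?_⟩
    -- The coefficients agree because `2 = 3 · ½ + ½` on `dϕ ∧ φ` and `-1 - 1/14 = -15/14` on `f ψ`.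
    · rw [hK.d_form, G.hodge_torsion_three, G.hodge_of_decomposition hHp, fmul_const_mul,
        fwedge_smul_left]
      module
    · rw [hK.d_psi, hodge_zero, fwedge_smul_left]
      module
    · exact G.form_fwedge_hodge_torsion_three _ hpsi
    · refine (G.torsion_three_fwedge_form _ _).trans ?_
      rw [hform]
      module
  · rintro ⟨Hp, τ₀, τ₁, τ₂, τ₃, hD, hT, h₀, rfl, rfl, rfl, -⟩
    obtain rfl : τ₀ = fun y => -(15 / 14) * f y := funext h₀
    refine ⟨?_, ?_, ?_, ?_⟩
    · rw [hT.d_form, G.hodge_torsion_three, G.hodge_of_decomposition hD.eq, fmul_const_mul,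
        fwedge_smul_left]
      module
    · rw [hT.d_psi, hodge_zero, fwedge_smul_left]
      module
    -- Here `τ₃ ∧ φ = 0` is what returns the dilaton equation.
    · have h := (G.torsion_three_fwedge_form (dFun ϕ) Hp).symm.trans hT.three_wedge_form
      rw [G.fwedge_form_of_decomposition hD.eq]
      have key : ∀ X Z : Form Y 6, -X - (2 : ℝ) • Z = 0 → Z = -((1 / 2 : ℝ) • X) := by
        intro X Z hXZ
        have hZ : Z = -((1 / 2 : ℝ) • X) + (-(1 / 2) : ℝ) • (-X - (2 : ℝ) • Z) := by module
        rw [hZ, hXZ]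
        module
      exact key _ _ h
    · rw [G.fwedge_psi_of_decomposition hD.eq, hD.wedge_psi]
      exact (add_zero _).symm

end G2Structure

/-! ### The exterior derivative of a product -/

section Leibniz

variable {V : Type*} [NormedAddCommGroup V] [NormedSpace ℝ V]

theorem alternatizeUncurryFin_smulRight_apply {k : ℕ} (a : V →L[ℝ] ℝ) (β : V [⋀^Fin k]→L[ℝ] ℝ)
    (v : Fin (k + 1) → V) :
    ContinuousAlternatingMap.alternatizeUncurryFin (a.smulRight β) v =
      ∑ i : Fin (k + 1), (Equiv.Perm.sign i.cycleRange.symm : ℝ) *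
        (a (v (i.cycleRange.symm 0)) * β fun j => v (i.cycleRange.symm j.succ)) := by
  rw [ContinuousAlternatingMap.alternatizeUncurryFin_apply]
  refine Finset.sum_congr rfl fun i _ => ?_
  rw [Equiv.Perm.sign_symm, Fin.sign_cycleRange, Fin.cycleRange_symm_zero]
  simp only [Fin.cycleRange_symm_succ]
  simp
  exact Or.inl rfl

/-- Antisymmetrise `A` in two ways. It is already alternating, which gives `(k + 1)! A`; expanding
it into its `k + 1` terms and absorbing each cycle into `σ` gives `k + 1` copies of the left side.
-/
theorem sum_perm_tensor {k : ℕ} (a : V →L[ℝ] ℝ) (β : V [⋀^Fin k]→L[ℝ] ℝ) (v : Fin (k + 1) → V) :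
    ∑ σ : Equiv.Perm (Fin (k + 1)), (Equiv.Perm.sign σ : ℝ) *
      (a (v (σ 0)) * β fun j => v (σ j.succ)) =
        (k ! : ℝ) * ContinuousAlternatingMap.alternatizeUncurryFin (a.smulRight β) v := by
  set A := ContinuousAlternatingMap.alternatizeUncurryFin (a.smulRight β) with hA
  have h1 : ∑ σ : Equiv.Perm (Fin (k + 1)), (Equiv.Perm.sign σ : ℝ) * A (v ∘ σ) =
      ((k + 1)! : ℝ) * A v := by
    have : ∀ σ : Equiv.Perm (Fin (k + 1)), (Equiv.Perm.sign σ : ℝ) * A (v ∘ σ) = A v := by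
      intro σ
      have h := A.toAlternatingMap.map_perm v σ
      simp only [ContinuousAlternatingMap.coe_toAlternatingMap, Units.smul_def,
        zsmul_eq_mul] at h
      have h' : A (v ∘ σ) = (Equiv.Perm.sign σ : ℝ) * A v := h
      rw [h', ← mul_assoc, sign_mul_sign, one_mul]
    simp [this, Fintype.card_perm]
  have h2 : ∑ σ : Equiv.Perm (Fin (k + 1)), (Equiv.Perm.sign σ : ℝ) * A (v ∘ σ) =
      ((k + 1 : ℕ) : ℝ) * ∑ σ : Equiv.Perm (Fin (k + 1)), (Equiv.Perm.sign σ : ℝ) *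
        (a (v (σ 0)) * β fun j => v (σ j.succ)) := by
    simp only [hA, alternatizeUncurryFin_smulRight_apply, Finset.mul_sum]
    rw [Finset.sum_comm, ← Finset.mul_sum]
    have : ∀ i : Fin (k + 1), ∑ σ : Equiv.Perm (Fin (k + 1)), (Equiv.Perm.sign σ : ℝ) *
        ((Equiv.Perm.sign i.cycleRange.symm : ℝ) * (a ((v ∘ σ) (i.cycleRange.symm 0)) *
          β fun j => (v ∘ σ) (i.cycleRange.symm j.succ))) =
        ∑ σ : Equiv.Perm (Fin (k + 1)), (Equiv.Perm.sign σ : ℝ) *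
          (a (v (σ 0)) * β fun j => v (σ j.succ)) := by
      intro i
      rw [← Equiv.sum_comp (Equiv.mulRight (i.cycleRange.symm : Equiv.Perm (Fin (k + 1))))
        fun σ : Equiv.Perm (Fin (k + 1)) => (Equiv.Perm.sign σ : ℝ) *
          (a (v (σ 0)) * β fun j => v (σ j.succ))]
      refine Finset.sum_congr rfl fun σ _ => ?_
      simp only [Equiv.coe_mulRight, Equiv.Perm.sign_mul, Units.val_mul, Int.cast_mul,
        Equiv.Perm.mul_apply, Function.comp_apply]
      ring
    rw [Finset.sum_congr rfl fun i _ => this i]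
    simp
  rw [h1] at h2
  have hk : ((k + 1 : ℕ) : ℝ) ≠ 0 := by positivity
  apply mul_left_cancel₀ hk
  rw [← h2, Nat.factorial_succ]
  push_cast
  ring

/-- Matches the normalisation `1 / (1! k!)` of `wedge` with the alternatization inside `extDeriv`.
The cast is needed because `1 + k` and `k + 1` differ definitionally for variable `k`. -/
theorem wedge_ofSubsingleton_apply {k : ℕ} (a : V →L[ℝ] ℝ) (β : V [⋀^Fin k]→L[ℝ] ℝ)
    (v : Fin (k + 1) → V) :
    wedge (ContinuousAlternatingMap.ofSubsingleton ℝ V ℝ (0 : Fin 1) a) β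
        (fun i => v (Fin.cast (add_comm 1 k) i)) =
      ContinuousAlternatingMap.alternatizeUncurryFin (a.smulRight β) v := by
  have hk : (k ! : ℝ) ≠ 0 := by positivity
  apply mul_left_cancel₀ hk
  rw [← sum_perm_tensor, wedge_apply,
    ← Equiv.sum_comp (finCongr (add_comm 1 k)).permCongr fun σ : Equiv.Perm (Fin (k + 1)) =>
      (Equiv.Perm.sign σ : ℝ) * (a (v (σ 0)) * β fun j => v (σ j.succ))]
  rw [Nat.factorial_one, Nat.cast_one, one_mul, mul_inv_cancel_left₀ hk]
  refine Finset.sum_congr rfl fun σ _ => ?_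
  rw [Equiv.Perm.sign_permCongr]
  have h0 : (finCongr (add_comm 1 k)).symm 0 = Fin.castAdd k 0 := by
    ext; simp
  have h1 : ∀ j : Fin k, (finCongr (add_comm 1 k)).symm j.succ = Fin.natAdd 1 j := by
    intro j; ext; simp [add_comm]
  simp only [Equiv.permCongr_apply, h0, h1]
  rfl

theorem extDeriv_mul_apply {k : ℕ} {g : V → ℝ} {θ : V → V [⋀^Fin k]→L[ℝ] ℝ} {z : V}
    (hg : DifferentiableAt ℝ g z) (hθ : DifferentiableAt ℝ θ z) (v : Fin (k + 1) → V) :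
    extDeriv (fun y => g y • θ y) z v =
      wedge (ContinuousAlternatingMap.ofSubsingleton ℝ V ℝ (0 : Fin 1) (fderiv ℝ g z)) (θ z)
        (fun i => v (Fin.cast (add_comm 1 k) i)) + g z * extDeriv θ z v := by
  rw [wedge_ofSubsingleton_apply, extDeriv, fderiv_fun_smul hg hθ,
    ContinuousAlternatingMap.alternatizeUncurryFin_add,
    ContinuousAlternatingMap.alternatizeUncurryFin_smul]
  exact add_comm _ _

/-- In a concrete degree `1 + 3` and `3 + 1` reduce to the same numeral, so the cast disappears. -/
theorem extDeriv_smul_three {g : V → ℝ} {θ : V → V [⋀^Fin 3]→L[ℝ] ℝ} {z : V}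
    (hg : DifferentiableAt ℝ g z) (hθ : DifferentiableAt ℝ θ z) :
    extDeriv (fun y => g y • θ y) z =
      (wedge (ContinuousAlternatingMap.ofSubsingleton ℝ V ℝ (0 : Fin 1) (fderiv ℝ g z)) (θ z) :
        V [⋀^Fin 4]→L[ℝ] ℝ) + g z • extDeriv θ z :=
  ContinuousAlternatingMap.ext fun v => extDeriv_mul_apply hg hθ v

theorem extDeriv_smul_four {g : V → ℝ} {θ : V → V [⋀^Fin 4]→L[ℝ] ℝ} {z : V}
    (hg : DifferentiableAt ℝ g z) (hθ : DifferentiableAt ℝ θ z) :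
    extDeriv (fun y => g y • θ y) z =
      (wedge (ContinuousAlternatingMap.ofSubsingleton ℝ V ℝ (0 : Fin 1) (fderiv ℝ g z)) (θ z) :
        V [⋀^Fin 5]→L[ℝ] ℝ) + g z • extDeriv θ z := by
  ext v
  have h := extDeriv_mul_apply (k := 4) hg hθ v
  generalize wedge (ContinuousAlternatingMap.ofSubsingleton ℝ V ℝ (0 : Fin 1) (fderiv ℝ g z))
    (θ z) = W at h ⊢
  rw [ContinuousAlternatingMap.add_apply]
  exact h

theorem contDiffAt_extDeriv {k : ℕ} {θ : V → V [⋀^Fin k]→L[ℝ] ℝ} {z : V}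
    (hθ : ContDiffAt ℝ ∞ θ z) : ContDiffAt ℝ ∞ (extDeriv θ) z := by
  have h1 : ContDiffAt ℝ ∞ (fderiv ℝ θ) z := hθ.fderiv_right (m := ∞) (by simp)
  have h2 := ContinuousLinearMap.contDiff (𝕜 := ℝ) (n := ∞) (E := V →L[ℝ] V [⋀^Fin k]→L[ℝ] ℝ)
    (F := V [⋀^Fin (k + 1)]→L[ℝ] ℝ) (ContinuousAlternatingMap.alternatizeUncurryFinCLM ℝ V ℝ)
  exact h2.contDiffAt.comp z h1

end Leibniz

/-! ### The exterior derivative on a manifold -/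

section Charts

variable {Y : Type*} [TopologicalSpace Y] [ChartedSpace E7 Y]

/-- The derivative of a chart. -/
noncomputable def chartDeriv (e : OpenPartialHomeomorph Y E7) (y : Y) : E7 →L[ℝ] E7 :=
  mfderiv (𝓡 7) (𝓡 7) e y

/-- The derivative of the inverse of a chart. -/
noncomputable def symmDeriv (e : OpenPartialHomeomorph Y E7) (z : E7) : E7 →L[ℝ] E7 :=
  mfderiv (𝓡 7) (𝓡 7) e.symm z

/-- The value of a form, with the tangent space identified with the model space. -/
def Form.val {k : ℕ} (α : Form Y k) (y : Y) : E7 [⋀^Fin k]→L[ℝ] ℝ := α y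

theorem inChart_apply {k : ℕ} (e : OpenPartialHomeomorph Y E7) (α : Form Y k) (z : E7) :
    inChart e α z = (Form.val α (e.symm z)).compContinuousLinearMap (symmDeriv e z) := rfl

theorem val_d {k : ℕ} (α : Form Y k) (x : Y) :
    Form.val (d α) x = (extDeriv (inChart (chartAt E7 x) α) (chartAt E7 x x)).compContinuousLinearMap
      (chartDeriv (chartAt E7 x) x) := rfl

variable {e e' : OpenPartialHomeomorph Y E7}

theorem IsSmooth.contDiffAt {k : ℕ} {α : Form Y k} (hα : IsSmooth α) (he : e ∈ atlas E7 Y) {z : E7}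
    (hz : z ∈ e.target) : ContDiffAt ℝ ∞ (inChart e α) z :=
  (hα e he).contDiffAt (e.open_target.mem_nhds hz)

theorem inChart_fmul {k : ℕ} (g : Y → ℝ) (α : Form Y k) :
    inChart e (fmul g α) = fun z => (g ∘ e.symm) z • inChart e α z := rfl

theorem minSmoothness_two_le : minSmoothness ℝ 2 ≤ (∞ : ℕ∞ω) := by
  simp only [minSmoothness_of_isRCLikeNormedField]
  exact WithTop.coe_le_coe.2 (le_top : (2 : ℕ∞) ≤ ⊤)

variable [IsManifold (𝓡 7) ∞ Y]

theorem isManifold_one : IsManifold (𝓡 7) 1 Y :=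
  IsManifold.of_le (n := ∞) (by simp)

theorem mdifferentiable_of_mem (he : e ∈ atlas E7 Y) : e.MDifferentiable (𝓡 7) (𝓡 7) := by
  have : IsManifold (𝓡 7) 1 Y := isManifold_one
  exact mdifferentiable_of_mem_atlas he

theorem symmDeriv_comp_chartDeriv (he : e ∈ atlas E7 Y) {y : Y} (hy : y ∈ e.source) :
    symmDeriv e (e y) ∘L chartDeriv e y = ContinuousLinearMap.id ℝ E7 :=
  (mdifferentiable_of_mem he).symm_comp_deriv hy

theorem chartDeriv_comp_symmDeriv (he : e ∈ atlas E7 Y) {z : E7} (hz : z ∈ e.target) :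
    chartDeriv e (e.symm z) ∘L symmDeriv e z = ContinuousLinearMap.id ℝ E7 :=
  (mdifferentiable_of_mem he).comp_symm_deriv hz

theorem fderiv_transition (he : e ∈ atlas E7 Y) (he' : e' ∈ atlas E7 Y) {z : E7}
    (hz : z ∈ e.target) (hz' : e.symm z ∈ e'.source) :
    fderiv ℝ (e' ∘ e.symm) z = chartDeriv e' (e.symm z) ∘L symmDeriv e z := by
  rw [← mfderiv_eq_fderiv]
  exact mfderiv_comp z ((mdifferentiable_of_mem he').mdifferentiableAt hz')
    ((mdifferentiable_of_mem he).mdifferentiableAt_symm hz)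

theorem contDiffAt_transition (he : e ∈ atlas E7 Y) (he' : e' ∈ atlas E7 Y) {z : E7}
    (hz : z ∈ e.target) (hz' : e.symm z ∈ e'.source) :
    ContDiffAt ℝ ∞ (e' ∘ e.symm) z := by
  rw [← contMDiffAt_iff_contDiffAt]
  exact (contMDiffAt_of_mem_maximalAtlas (n := ∞) (IsManifold.subset_maximalAtlas he') hz').comp z
    (contMDiffAt_symm_of_mem_maximalAtlas (IsManifold.subset_maximalAtlas he) hz)

/-- The derivative of `e'.symm` cancels that of `e'` in the chain rule for the transition map. -/
theorem inChart_eq_pullback (he : e ∈ atlas E7 Y) (he' : e' ∈ atlas E7 Y) {k : ℕ} (α : Form Y k)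
    {z : E7} (hz : z ∈ e.target) (hz' : e.symm z ∈ e'.source) :
    inChart e α z = (inChart e' α ((e' ∘ e.symm) z)).compContinuousLinearMap
      (fderiv ℝ (e' ∘ e.symm) z) := by
  rw [fderiv_transition he he' hz hz', inChart_apply, inChart_apply]
  have h1 : e'.symm ((e' ∘ e.symm) z) = e.symm z := e'.left_inv hz'
  have h2 := symmDeriv_comp_chartDeriv he' hz'
  rw [h1]
  ext v
  simp only [ContinuousAlternatingMap.compContinuousLinearMap_apply]
  congr 1
  funext i
  have := congrArg (fun L : E7 →L[ℝ] E7 => L (symmDeriv e z (v i))) h2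
  exact this.symm

theorem extDeriv_inChart_eq_pullback (he : e ∈ atlas E7 Y) (he' : e' ∈ atlas E7 Y) {k : ℕ}
    {α : Form Y k} {z : E7} (hz : z ∈ e.target) (hz' : e.symm z ∈ e'.source)
    (hα : DifferentiableAt ℝ (inChart e' α) ((e' ∘ e.symm) z)) :
    extDeriv (inChart e α) z = (extDeriv (inChart e' α) ((e' ∘ e.symm) z)).compContinuousLinearMap
      (fderiv ℝ (e' ∘ e.symm) z) := by
  rw [← extDeriv_pullback (r := ∞) hα (contDiffAt_transition he he' hz hz') minSmoothness_two_le]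
  apply Filter.EventuallyEq.extDeriv_eq
  have hopen : ∀ᶠ w in 𝓝 z, w ∈ e.target ∧ e.symm w ∈ e'.source :=
    (e.open_target.eventually_mem hz).and
      ((e.continuousAt_symm hz).eventually (e'.open_source.mem_nhds hz'))
  exact hopen.mono fun w hw => inChart_eq_pullback he he' α hw.1 hw.2

/-- `d` uses a different preferred chart at each point. Naturality of `extDeriv` under transition
maps shows that any one chart computes it throughout its domain, which is what allows `d` to be
iterated. -/
theorem inChart_d (he : e ∈ atlas E7 Y) {k : ℕ} {α : Form Y k} (hα : IsSmooth α) {z : E7}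
    (hz : z ∈ e.target) : inChart e (d α) z = extDeriv (inChart e α) z := by
  have hz' : e.symm z ∈ (chartAt E7 (e.symm z)).source := mem_chart_source _ _
  have he' : chartAt E7 (e.symm z) ∈ atlas E7 Y := chart_mem_atlas _ _
  rw [extDeriv_inChart_eq_pullback he he' hz hz' ((hα.contDiffAt he' ?_).differentiableAt (by simp)),
    fderiv_transition he he' hz hz', inChart_apply, val_d]
  · rfl
  · exact (chartAt E7 (e.symm z)).map_source hz'

theorem isSmooth_d {k : ℕ} {α : Form Y k} (hα : IsSmooth α) : IsSmooth (d α) := by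
  intro e he z hz
  refine ContDiffAt.contDiffWithinAt ?_
  refine (contDiffAt_extDeriv (hα.contDiffAt he hz)).congr_of_eventuallyEq ?_
  filter_upwards [e.open_target.mem_nhds hz] with w hw using inChart_d he hα hw

theorem d_d {k : ℕ} {α : Form Y k} (hα : IsSmooth α) : d (d α) = 0 := by
  funext x
  have he : chartAt E7 x ∈ atlas E7 Y := chart_mem_atlas _ _
  have hz := mem_chart_target E7 x
  -- The outer derivative sees `d α` near the point, so agreement at the point alone would not
  -- suffice.
  have h : inChart (chartAt E7 x) (d α) =ᶠ[𝓝 (chartAt E7 x x)]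
      extDeriv (inChart (chartAt E7 x) α) := by
    filter_upwards [(chartAt E7 x).open_target.mem_nhds hz] with w hw using inChart_d he hα hw
  change Form.val (d (d α)) x = 0
  rw [val_d, h.extDeriv_eq, extDeriv_extDeriv_apply (hα.contDiffAt he hz)
    minSmoothness_two_le]
  rfl

theorem fderiv_comp_symm (g : Y → ℝ) (hg : ContMDiff (𝓡 7) 𝓘(ℝ, ℝ) ∞ g) (x : Y) :
    (mvfderiv (𝓡 7) g x : E7 →L[ℝ] ℝ) = fderiv ℝ (g ∘ (chartAt E7 x).symm) (chartAt E7 x x) ∘L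
      chartDeriv (chartAt E7 x) x := by
  have he : chartAt E7 x ∈ atlas E7 Y := chart_mem_atlas _ _
  have hx := mem_chart_source E7 x
  have hz := mem_chart_target E7 x
  have hs : MDifferentiableAt (𝓡 7) (𝓡 7) (chartAt E7 x).symm (chartAt E7 x x) :=
    (mdifferentiable_of_mem he).mdifferentiableAt_symm hz
  have hg' : MDifferentiableAt (𝓡 7) 𝓘(ℝ, ℝ) g ((chartAt E7 x).symm (chartAt E7 x x)) :=
    hg.mdifferentiable (by simp) _
  have h1 := mfderiv_comp (chartAt E7 x x) hg' hs
  rw [← mfderiv_eq_fderiv, h1]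
  rw [(chartAt E7 x).left_inv hx]
  ext v
  have := congrArg (fun L : E7 →L[ℝ] E7 => L v) (symmDeriv_comp_chartDeriv he hx)
  exact (congrArg (fun w => mfderiv (𝓡 7) 𝓘(ℝ, ℝ) g x w) this).symm

theorem contDiffAt_comp_symm {g : Y → ℝ} (hg : ContMDiff (𝓡 7) 𝓘(ℝ, ℝ) ∞ g)
    (he : e ∈ atlas E7 Y) {z : E7} (hz : z ∈ e.target) : ContDiffAt ℝ ∞ (g ∘ e.symm) z := by
  rw [← contMDiffAt_iff_contDiffAt]
  exact hg.contMDiffAt.comp z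
    (contMDiffAt_symm_of_mem_maximalAtlas (IsManifold.subset_maximalAtlas he) hz)

theorem isSmooth_fmul {k : ℕ} {g : Y → ℝ} (hg : ContMDiff (𝓡 7) 𝓘(ℝ, ℝ) ∞ g) {α : Form Y k}
    (hα : IsSmooth α) : IsSmooth (fmul g α) := by
  intro e he z hz
  exact ((contDiffAt_comp_symm hg he hz).smul (hα.contDiffAt he hz)).contDiffWithinAt

theorem val_eq_inChart_comp {k : ℕ} (α : Form Y k) (x : Y) :
    (inChart (chartAt E7 x) α (chartAt E7 x x)).compContinuousLinearMap
      (chartDeriv (chartAt E7 x) x) = Form.val α x := by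
  have hx := mem_chart_source E7 x
  rw [inChart_apply, (chartAt E7 x).left_inv hx]
  ext v
  simp only [ContinuousAlternatingMap.compContinuousLinearMap_apply]
  congr 1
  funext i
  exact congrArg (fun L : E7 →L[ℝ] E7 => L (v i))
    (symmDeriv_comp_chartDeriv (chart_mem_atlas E7 x) hx)

theorem val_dFun {g : Y → ℝ} (hg : ContMDiff (𝓡 7) 𝓘(ℝ, ℝ) ∞ g) (x : Y) :
    Form.val (dFun g) x = (ContinuousAlternatingMap.ofSubsingleton ℝ E7 ℝ (0 : Fin 1)
      (fderiv ℝ (g ∘ (chartAt E7 x).symm) (chartAt E7 x x))).compContinuousLinearMap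
        (chartDeriv (chartAt E7 x) x) := by
  have := fderiv_comp_symm g hg x
  change ContinuousAlternatingMap.ofSubsingleton ℝ E7 ℝ (0 : Fin 1)
    (mvfderiv (𝓡 7) g x : E7 →L[ℝ] ℝ) = _
  rw [this]
  rfl

/-- Differentiability at the chart centres suffices, since `d` is evaluated there. The weak form of
the hypothesis matters in degree four, where `ψ` is shown to be differentiable rather than smooth.
-/
theorem d_fmul_three {g : Y → ℝ} (hg : ContMDiff (𝓡 7) 𝓘(ℝ, ℝ) ∞ g) {α : Form Y 3}
    (hα : ∀ x, DifferentiableAt ℝ (inChart (chartAt E7 x) α) (chartAt E7 x x)) :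
    (d (fmul g α) : Form Y 4) =
      (fwedge (dFun g) α : Form Y 4) + fmul g (d α) := by
  funext x
  have he : chartAt E7 x ∈ atlas E7 Y := chart_mem_atlas _ _
  have hz := mem_chart_target E7 x
  have hx := mem_chart_source E7 x
  change Form.val (d (fmul g α)) x = (wedge (Form.val (dFun g) x) (Form.val α x) :
    E7 [⋀^Fin 4]→L[ℝ] ℝ) + g x • Form.val (d α) x
  rw [val_d, val_d, inChart_fmul, extDeriv_smul_three
    ((contDiffAt_comp_symm hg he hz).differentiableAt (by simp))
    (hα x)]
  rw [← val_eq_inChart_comp α x]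
  rw [val_dFun hg, ← wedge_compContinuousLinearMap]
  rw [Function.comp_apply, (chartAt E7 x).left_inv hx]
  rfl

theorem d_fmul_four {g : Y → ℝ} (hg : ContMDiff (𝓡 7) 𝓘(ℝ, ℝ) ∞ g) {α : Form Y 4}
    (hα : ∀ x, DifferentiableAt ℝ (inChart (chartAt E7 x) α) (chartAt E7 x x)) :
    (d (fmul g α) : Form Y 5) =
      (fwedge (dFun g) α : Form Y 5) + fmul g (d α) := by
  funext x
  have he : chartAt E7 x ∈ atlas E7 Y := chart_mem_atlas _ _
  have hz := mem_chart_target E7 x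
  have hx := mem_chart_source E7 x
  have key : Form.val (d (fmul g α)) x = (wedge (Form.val (dFun g) x) (Form.val α x) :
      E7 [⋀^Fin 5]→L[ℝ] ℝ) + g x • Form.val (d α) x := by
    rw [val_d, val_d, inChart_fmul, extDeriv_smul_four
      ((contDiffAt_comp_symm hg he hz).differentiableAt (by simp)) (hα x)]
    rw [← val_eq_inChart_comp α x]
    rw [val_dFun hg, ← wedge_compContinuousLinearMap]
    rw [Function.comp_apply, (chartAt E7 x).left_inv hx]
    generalize wedge (ContinuousAlternatingMap.ofSubsingleton ℝ E7 ℝ (0 : Fin 1)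
      (fderiv ℝ (g ∘ (chartAt E7 x).symm) (chartAt E7 x x)))
      (inChart (chartAt E7 x) α (chartAt E7 x x)) = W
    rfl
  rw [Pi.add_apply]
  refine key.trans ?_
  have h1 : (wedge (Form.val (dFun g) x) (Form.val α x) : E7 [⋀^Fin 5]→L[ℝ] ℝ) =
    (fwedge (dFun g) α : Form Y 5) x := rfl
  rw [h1]
  rfl

end Charts

/-! ### The flux equation of motion -/

section Exponential

variable {Y : Type*} [TopologicalSpace Y] [ChartedSpace E7 Y]

theorem contMDiff_exp_mul {ϕ : Y → ℝ} (hϕ : ContMDiff (𝓡 7) 𝓘(ℝ, ℝ) ∞ ϕ) (c : ℝ) :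
    ContMDiff (𝓡 7) 𝓘(ℝ, ℝ) ∞ fun y => Real.exp (c * ϕ y) := by
  have h : ContDiff ℝ ∞ fun t : ℝ => Real.exp (c * t) := by fun_prop
  exact h.contMDiff.comp hϕ

theorem d_add {k : ℕ} {α β : Form Y k}
    (hα : ∀ x, DifferentiableAt ℝ (inChart (chartAt E7 x) α) (chartAt E7 x x))
    (hβ : ∀ x, DifferentiableAt ℝ (inChart (chartAt E7 x) β) (chartAt E7 x x)) :
    d (α + β) = d α + d β := by
  funext x
  change Form.val (d (α + β)) x = Form.val (d α) x + Form.val (d β) x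
  have h : inChart (chartAt E7 x) (α + β) =
    inChart (chartAt E7 x) α + inChart (chartAt E7 x) β := rfl
  rw [val_d, h, extDeriv_add (hα x) (hβ x)]
  rfl

theorem d_smul {k : ℕ} (c : ℝ) (α : Form Y k) : d (c • α) = c • d α := by
  funext x
  change Form.val (d (c • α)) x = c • Form.val (d α) x
  have h : inChart (chartAt E7 x) (c • α) = c • inChart (chartAt E7 x) α := rfl
  rw [val_d, h, extDeriv_smul]
  rfl

variable [IsManifold (𝓡 7) ∞ Y]

theorem dFun_exp_mul {ϕ : Y → ℝ} (hϕ : ContMDiff (𝓡 7) 𝓘(ℝ, ℝ) ∞ ϕ) (c : ℝ) :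
    dFun (fun y => Real.exp (c * ϕ y)) = fmul (fun y => c * Real.exp (c * ϕ y)) (dFun ϕ) := by
  funext x
  change Form.val (dFun fun y => Real.exp (c * ϕ y)) x =
    (c * Real.exp (c * ϕ x)) • Form.val (dFun ϕ) x
  rw [val_dFun (contMDiff_exp_mul hϕ c), val_dFun hϕ]
  have hd : DifferentiableAt ℝ (ϕ ∘ (chartAt E7 x).symm) (chartAt E7 x x) :=
    (contDiffAt_comp_symm hϕ (chart_mem_atlas E7 x) (mem_chart_target E7 x)).differentiableAt
      (by simp)
  have h := ((hd.hasFDerivAt.const_mul c).exp).fderiv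
  have h' : fderiv ℝ ((fun y => Real.exp (c * ϕ y)) ∘ (chartAt E7 x).symm) (chartAt E7 x x) =
      (c * Real.exp (c * ϕ x)) • fderiv ℝ (ϕ ∘ (chartAt E7 x).symm) (chartAt E7 x x) := by
    refine h.trans ?_
    rw [Function.comp_apply, (chartAt E7 x).left_inv (mem_chart_source E7 x), smul_smul, mul_comm]
  rw [h']
  rfl

end Exponential

namespace G2Structure

variable {Y : Type*} [TopologicalSpace Y] [ChartedSpace E7 Y] [IsManifold (𝓡 7) ∞ Y]
  {G : G2Structure Y} {ϕ f : Y → ℝ} {H : Form Y 3}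

/-- `e^{-2ϕ} ψ` is closed. -/
theorem KillingSpinor.d_exp_psi (hK : G.KillingSpinor ϕ H f)
    (hϕ : ContMDiff (𝓡 7) 𝓘(ℝ, ℝ) ∞ ϕ)
    (hψ : ∀ x, DifferentiableAt ℝ (inChart (chartAt E7 x) G.psi) (chartAt E7 x x)) :
    d (fmul (fun y => Real.exp (-2 * ϕ y)) G.psi) = 0 := by
  -- The term `-2 dϕ ∧ ψ` from the exponential cancels `dψ = 2 dϕ ∧ ψ`.
  rw [d_fmul_four (contMDiff_exp_mul hϕ (-2)) hψ, dFun_exp_mul hϕ, hK.d_psi, fwedge_fmul_left]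
  generalize (fwedge (dFun ϕ) G.psi : Form Y 5) = X
  funext x
  change (-2 * Real.exp (-2 * ϕ x)) • X x + Real.exp (-2 * ϕ x) • (2 : ℝ) • X x = 0
  module

/-- `e^{-2ϕ} *H = -d(e^{-2ϕ} φ) - f e^{-2ϕ} ψ`. -/
theorem KillingSpinor.exp_star_flux (hK : G.KillingSpinor ϕ H f)
    (hϕ : ContMDiff (𝓡 7) 𝓘(ℝ, ℝ) ∞ ϕ) :
    fmul (fun y => Real.exp (-2 * ϕ y)) (G.hodge (k := 3) (q := 4) rfl H) =
      (-1 : ℝ) • d (fmul (fun y => Real.exp (-2 * ϕ y)) G.form) +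
        fmul (fun y => -f y) (fmul (fun y => Real.exp (-2 * ϕ y)) G.psi) := by
  have hφ : ∀ x, DifferentiableAt ℝ (inChart (chartAt E7 x) G.form) (chartAt E7 x x) := fun x =>
    (G.smooth.contDiffAt (chart_mem_atlas E7 x) (mem_chart_target E7 x)).differentiableAt (by simp)
  rw [d_fmul_three (contMDiff_exp_mul hϕ (-2)) hφ, dFun_exp_mul hϕ, hK.d_form, fwedge_fmul_left]
  generalize (fwedge (dFun ϕ) G.form : Form Y 4) = X
  generalize G.hodge (k := 3) (q := 4) rfl H = Z
  funext x
  change Real.exp (-2 * ϕ x) • Z x = (-1 : ℝ) • ((-2 * Real.exp (-2 * ϕ x)) • X x +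
    Real.exp (-2 * ϕ x) • ((2 : ℝ) • X x - Z x - f x • G.psi x)) +
      (-f x) • Real.exp (-2 * ϕ x) • G.psi x
  module

theorem KillingSpinor.fluxEOM (hK : G.KillingSpinor ϕ H f)
    (hϕ : ContMDiff (𝓡 7) 𝓘(ℝ, ℝ) ∞ ϕ)
    (hψ : ∀ x, DifferentiableAt ℝ (inChart (chartAt E7 x) G.psi) (chartAt E7 x x))
    (hB : Bianchi H f) : G.FluxEOM ϕ H := by
  obtain ⟨-, c, hc⟩ := hB
  obtain rfl : f = fun _ => c := funext hc
  have hE := contMDiff_exp_mul hϕ (-2)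
  have hs := isSmooth_fmul hE G.smooth
  have hc : fmul (fun _ : Y => -c) (fmul (fun y => Real.exp (-2 * ϕ y)) G.psi) =
    (-c) • fmul (fun y => Real.exp (-2 * ϕ y)) G.psi := rfl
  -- An exact form plus a constant multiple of the closed form `e^{-2ϕ} ψ`.
  rw [FluxEOM, hodge_fmul, hK.exp_star_flux hϕ, hc, d_add, d_smul, d_smul, hK.d_exp_psi hϕ hψ]
  · have := d_d hs
    rw [this]
    simp
  · intro x
    exact ((((isSmooth_d hs).contDiffAt (chart_mem_atlas E7 x)
      (mem_chart_target E7 x)).differentiableAt (by simp)).const_smul (-1 : ℝ) :)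
  · intro x
    exact ((((contDiffAt_comp_symm hE (chart_mem_atlas E7 x)
      (mem_chart_target E7 x)).differentiableAt (by simp)).smul (hψ x)).const_smul (-c) :)

end G2Structure

/-! ### The four-form as a differentiable function of the three-form -/

theorem sum_smul_basisVec (u : E7) : ∑ i, u i • basisVec i = u := by
  have := (EuclideanSpace.basisFun (Fin 7) ℝ).sum_repr u
  simpa [basisVec] using this

theorem multilinear_apply_eq_sum {k : ℕ} (F : MultilinearMap ℝ (fun _ : Fin k => E7) ℝ)
    (v : Fin k → E7) :
    F v = ∑ I : Fin k → Fin 7, (∏ a, v a (I a)) * F (basisTuple I) := by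
  conv_lhs => rw [show v = fun a => ∑ i, v a i • basisVec i from
    funext fun a => (sum_smul_basisVec (v a)).symm]
  rw [F.map_sum]
  refine Finset.sum_congr rfl fun I _ => ?_
  rw [F.map_smul_univ]
  rfl

/-- The volume form as a multilinear map. -/
def volMultilinear : MultilinearMap ℝ (fun _ : Fin 7 => E7) ℝ where
  toFun := vol0
  map_update_add' := by
    intro inst v i x y
    rw [Subsingleton.elim inst (instDecidableEqFin 7)]
    exact vol0_update_add v i x y
  map_update_smul' := by
    intro inst v i c x
    rw [Subsingleton.elim inst (instDecidableEqFin 7)]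
    exact vol0_update_smul v i c x

theorem volMultilinear_apply (v : Fin 7 → E7) : volMultilinear v = vol0 v := rfl

/-- Puts the volume, as a function of its first block, in the form required by `sum_mul_adjoint`. -/
theorem exists_volAppend_multilinear {k q : ℕ} (h : k + q = 7) (w : Fin q → E7) :
    ∃ T : MultilinearMap ℝ (fun _ : Fin k => E7) ℝ, ∀ u, T u = volAppend h u w := by
  have h' : q + k = 7 := by omega
  refine ⟨MultilinearMap.currySum
    (volMultilinear.domDomCongr (finSumFinEquiv.trans (finCongr h')).symm) w, fun u => ?_⟩
  rw [← volAppend_swap h h', MultilinearMap.currySum_apply', MultilinearMap.domDomCongr_apply,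
    volMultilinear_apply, volAppend]
  congr 1
  funext m
  obtain ⟨n, rfl⟩ := (finSumFinEquiv.trans (finCongr h')).surjective m
  rcases n with a | a <;> simp

theorem adjoint_apply (A : E7 →L[ℝ] E7) (i j : Fin 7) :
    ContinuousLinearMap.adjoint A (basisVec i) j = A (basisVec j) i := by
  have h := ContinuousLinearMap.adjoint_inner_left A (basisVec j) (basisVec i)
  simpa [basisVec, EuclideanSpace.inner_single_left, EuclideanSpace.inner_single_right] using h

/-- In components the adjoint is the transposed matrix, so a full contraction over basis tuples lets
`A` pass from one factor to the other. -/
theorem sum_mul_adjoint {k : ℕ} (F T : MultilinearMap ℝ (fun _ : Fin k => E7) ℝ)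
    (A : E7 →L[ℝ] E7) :
    ∑ I : Fin k → Fin 7, F (fun a => A (basisTuple I a)) * T (basisTuple I) =
      ∑ I : Fin k → Fin 7, F (basisTuple I) *
        T fun a => ContinuousLinearMap.adjoint A (basisTuple I a) := by
  simp only [multilinear_apply_eq_sum F fun a => A _,
    multilinear_apply_eq_sum T fun a => ContinuousLinearMap.adjoint A _, Finset.sum_mul,
    Finset.mul_sum]
  rw [Finset.sum_comm]
  refine Finset.sum_congr rfl fun I _ => Finset.sum_congr rfl fun J _ => ?_
  simp only [basisTuple, adjoint_apply]
  ring

/-- The determinant of an endomorphism of `ℝ⁷`. -/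
noncomputable def endDet (A : E7 →L[ℝ] E7) : ℝ := vol0 fun i => A (basisVec i)

theorem vol0_map (A : E7 →L[ℝ] E7) (v : Fin 7 → E7) :
    vol0 (fun i => A (v i)) = endDet A * vol0 v := by
  have h : (Matrix.of fun i j => A (v i) j) =
      (Matrix.of fun i j => v i j) * (Matrix.of fun i j => A (basisVec i) j) := by
    ext i j
    rw [Matrix.mul_apply]
    conv_lhs => rw [Matrix.of_apply, ← sum_smul_basisVec (v i), map_sum]
    simp
  rw [vol0, h, Matrix.det_mul, mul_comm]
  rfl

theorem endDet_comp (A B : E7 →L[ℝ] E7) : endDet (A ∘L B) = endDet A * endDet B :=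
  vol0_map A fun i => B (basisVec i)

theorem endDet_adjoint (A : E7 →L[ℝ] E7) :
    endDet (ContinuousLinearMap.adjoint A) = endDet A := by
  rw [endDet, endDet, vol0, vol0, ← Matrix.det_transpose]
  congr 1
  ext i j
  simp [adjoint_apply]

theorem endDet_smul (c : ℝ) (A : E7 →L[ℝ] E7) : endDet (c • A) = c ^ 7 * endDet A := by
  have := Matrix.det_smul (Matrix.of fun i j => A (basisVec i) j) c
  rw [Fintype.card_fin] at this
  exact this

theorem endDet_id : endDet (ContinuousLinearMap.id ℝ E7) = 1 := vol0_basisVec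

/-- Naturality of the Hodge star under an endomorphism. -/
theorem hodge0_comp_adjoint {k q : ℕ} (h : k + q = 7) (A : E7 →L[ℝ] E7)
    (α : E7 [⋀^Fin k]→L[ℝ] ℝ) :
    (hodge0 h (α.compContinuousLinearMap (ContinuousLinearMap.adjoint A))).compContinuousLinearMap
      A = endDet A • hodge0 h α := by
  ext w
  simp only [ContinuousAlternatingMap.compContinuousLinearMap_apply,
    ContinuousAlternatingMap.smul_apply, hodge0_apply, smul_eq_mul]
  have hvol : ∀ u : Fin k → E7, volAppend h (fun a => A (u a)) (fun b => A (w b)) =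
      endDet A * volAppend h u w := by
    intro u
    rw [volAppend, volAppend, ← vol0_map]
    congr 1
    funext m
    obtain ⟨n, rfl⟩ := (finCongr h).surjective m
    refine Fin.addCases (fun a => ?_) (fun b => ?_) n <;> simp
  obtain ⟨T, hT⟩ := exists_volAppend_multilinear h fun b => A (w b)
  -- The adjoint moves off `α` and becomes `A` on the first block of the volume; all seven vectors
  -- then carry `A`, and `det A` factors out.
  have key := sum_mul_adjoint α.toMultilinearMap T (ContinuousLinearMap.adjoint A)
  rw [ContinuousLinearMap.adjoint_adjoint] at key
  simp only [hT] at key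
  rw [mul_left_comm]
  congr 1
  refine key.trans ?_
  rw [Finset.mul_sum]
  refine Finset.sum_congr rfl fun I _ => ?_
  rw [hvol]
  exact mul_left_comm _ _ _

/-- The density-valued metric `b(u, v)` of a three-form `θ`: for a `G₂` form, a multiple of
`(u ⌟ θ) ∧ (v ⌟ θ) ∧ θ`. -/
noncomputable def formMetric (θ : E7 [⋀^Fin 3]→L[ℝ] ℝ) (u v : E7) : ℝ :=
  ∑ P : Fin (2 + 2) → Fin 7, tensor (θ.curryLeft u) (θ.curryLeft v) (basisTuple P) *
    hodge0 (k := 3) (q := 2 + 2) rfl θ (basisTuple P)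

theorem sum_tuple_four {M : Type*} [AddCommMonoid M] (F : (Fin 4 → Fin 7) → M) :
    ∑ I, F I = ∑ i, ∑ j, ∑ k, ∑ l, F ![i, j, k, l] := by
  simp only [sum_tuple_succ, Fintype.sum_unique]
  rfl

/-- `φ_{iab} ψ_{abcd} = 4 φ_{icd}` and `φ_{icd} φ_{jcd} = 6 δ_{ij}`. -/
theorem formMetric_phi0_basis (i j : Fin 7) :
    formMetric phi0 (basisVec i) (basisVec j) = 24 * delta i j := by
  have hP : ∀ a b c d : Fin 7, tensor (k := 2) (l := 2) (phi0.curryLeft (basisVec i))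
      (phi0.curryLeft (basisVec j)) (basisTuple ![a, b, c, d]) =
      (phiCoeff i a b : ℝ) * phiCoeff j c d := by
    intro a b c d
    rw [← phi0_basis, ← phi0_basis]
    refine congrArg₂ (· * ·) (congrArg phi0 ?_) (congrArg phi0 ?_) <;>
      (funext m; fin_cases m <;> rfl)
  have hz : ∑ a, ∑ b, ∑ c, ∑ d, phiCoeff i a b * phiCoeff j c d * psiCoeff a b c d =
      24 * delta i j := by
    have : ∀ c d, ∑ a, ∑ b, phiCoeff i a b * phiCoeff j c d * psiCoeff a b c d =
        4 * (phiCoeff i c d * phiCoeff j c d) := by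
      intro c d
      rw [← mul_assoc, ← sum_phiCoeff_mul_psiCoeff, Finset.sum_mul]
      refine Finset.sum_congr rfl fun a _ => ?_
      rw [Finset.sum_mul]
      exact Finset.sum_congr rfl fun b _ => by ring
    calc _ = ∑ c, ∑ d, ∑ a, ∑ b, phiCoeff i a b * phiCoeff j c d * psiCoeff a b c d := by
          rw [Finset.sum_congr rfl fun a _ => Finset.sum_comm, Finset.sum_comm]
          refine Finset.sum_congr rfl fun c _ => ?_
          rw [Finset.sum_congr rfl fun a _ => Finset.sum_comm, Finset.sum_comm]
      _ = 24 * delta i j := by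
          simp only [this, ← Finset.mul_sum, sum_phiCoeff_mul_phiCoeff]
          ring
  have h := congrArg (Int.cast (R := ℝ)) hz
  push_cast at h
  rw [← h]
  refine (sum_tuple_four _).trans ?_
  refine Finset.sum_congr rfl fun a _ => Finset.sum_congr rfl fun b _ =>
    Finset.sum_congr rfl fun c _ => Finset.sum_congr rfl fun d _ => ?_
  exact congrArg₂ (· * ·) (hP a b c d) (psi0_basis a b c d)

theorem curryLeft_eq_sum (θ : E7 [⋀^Fin 3]→L[ℝ] ℝ) (u : E7) :
    θ.curryLeft u = ∑ i, u i • θ.curryLeft (basisVec i) := by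
  conv_lhs => rw [← sum_smul_basisVec u, map_sum]
  simp only [map_smul]

theorem formMetric_phi0 (u v : E7) : formMetric phi0 u v = 24 * ∑ i, u i * v i := by
  have h : formMetric phi0 u v =
      ∑ i, ∑ j, u i * v j * formMetric phi0 (basisVec i) (basisVec j) := by
    have ht : ∀ P : Fin (2 + 2) → Fin 7,
        tensor (phi0.curryLeft u) (phi0.curryLeft v) (basisTuple P) = ∑ i, ∑ j, u i * v j *
          tensor (phi0.curryLeft (basisVec i)) (phi0.curryLeft (basisVec j)) (basisTuple P) := by
      intro P
      change phi0.curryLeft u (fun i => basisTuple P (Fin.castAdd 2 i)) *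
        phi0.curryLeft v (fun i => basisTuple P (Fin.natAdd 2 i)) = _
      rw [curryLeft_eq_sum phi0 u, curryLeft_eq_sum phi0 v]
      simp only [ContinuousAlternatingMap.sum_apply, ContinuousAlternatingMap.smul_apply,
        smul_eq_mul]
      rw [Finset.sum_mul_sum]
      refine Finset.sum_congr rfl fun i _ => Finset.sum_congr rfl fun j _ => ?_
      exact mul_mul_mul_comm _ _ _ _
    simp only [formMetric, ht, Finset.sum_mul, Finset.mul_sum]
    rw [Finset.sum_comm]
    refine Finset.sum_congr rfl fun i _ => ?_
    rw [Finset.sum_comm]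
    refine Finset.sum_congr rfl fun j _ => Finset.sum_congr rfl fun P _ => ?_
    ring
  rw [h, Finset.mul_sum]
  refine Finset.sum_congr rfl fun i _ => ?_
  rw [Finset.sum_eq_single i]
  · rw [formMetric_phi0_basis]
    simp [delta]
    ring
  · intro j _ hj
    rw [formMetric_phi0_basis, ← basisVec_apply]
    simp [basisVec, hj]
  · simp

/-- Pass `A` from the contractions of `θ` to the Hodge dual, where it appears as its adjoint;
naturality of the star then produces the determinant. -/
theorem formMetric_comp (θ : E7 [⋀^Fin 3]→L[ℝ] ℝ) (A : E7 →L[ℝ] E7) (u v : E7) :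
    formMetric (θ.compContinuousLinearMap A) u v = endDet A * formMetric θ (A u) (A v) := by
  have key := sum_mul_adjoint (tensor (θ.curryLeft (A u)) (θ.curryLeft (A v))).toMultilinearMap
    (hodge0 (k := 3) (q := 2 + 2) rfl (θ.compContinuousLinearMap A)).toMultilinearMap A
  have h1 : ∀ w : E7, (θ.compContinuousLinearMap A).curryLeft w =
      (θ.curryLeft (A w)).compContinuousLinearMap A := fun w =>
    ContinuousAlternatingMap.curryLeft_compContinuousLinearMap θ A w
  have h2 := hodge0_comp_adjoint (k := 3) (q := 2 + 2) rfl (ContinuousLinearMap.adjoint A) θ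
  rw [ContinuousLinearMap.adjoint_adjoint, endDet_adjoint] at h2
  simp only [formMetric, h1]
  refine Eq.trans ?_ (key.trans ?_)
  · rfl
  · rw [Finset.mul_sum]
    refine Finset.sum_congr rfl fun P _ => ?_
    have h3 := congrArg (fun α => α (basisTuple P)) h2
    refine (congrArg (tensor (θ.curryLeft (A u)) (θ.curryLeft (A v)) (basisTuple P) * ·) h3).trans ?_
    exact mul_left_comm _ _ _

/-- The operator with matrix `formMetric θ`. -/
noncomputable def metricOp (θ : E7 [⋀^Fin 3]→L[ℝ] ℝ) : E7 →L[ℝ] E7 :=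
  ∑ i, ∑ j, formMetric θ (basisVec i) (basisVec j) •
    (EuclideanSpace.proj i : E7 →L[ℝ] ℝ).smulRight (basisVec j)

theorem ext_basisVec {A B : E7 →L[ℝ] E7} (h : ∀ i j, A (basisVec i) j = B (basisVec i) j) :
    A = B := by
  ext u j
  rw [← sum_smul_basisVec u]
  simp [h]

theorem metricOp_apply (θ : E7 [⋀^Fin 3]→L[ℝ] ℝ) (i j : Fin 7) :
    metricOp θ (basisVec i) j = formMetric θ (basisVec i) (basisVec j) := by
  simp [metricOp, basisVec, Finset.sum_apply, Pi.single_apply]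

theorem metricOp_phi0_comp (A : E7 →L[ℝ] E7) :
    metricOp (phi0.compContinuousLinearMap A) =
      (24 * endDet A) • (ContinuousLinearMap.adjoint A ∘L A) := by
  refine ext_basisVec fun i j => ?_
  rw [metricOp_apply, formMetric_comp, formMetric_phi0]
  have h : (ContinuousLinearMap.adjoint A ∘L A) (basisVec i) j =
      ∑ a, A (basisVec i) a * A (basisVec j) a := by
    rw [ContinuousLinearMap.comp_apply]
    conv_lhs => rw [← sum_smul_basisVec (A (basisVec i)), map_sum]
    simp [adjoint_apply]
  rw [_root_.smul_apply, PiLp.smul_apply, h, smul_eq_mul]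
  ring

/-- The four-form determined by a positive three-form. -/
noncomputable def psiOf (θ : E7 [⋀^Fin 3]→L[ℝ] ℝ) : E7 [⋀^Fin 4]→L[ℝ] ℝ :=
  (((endDet (metricOp θ) / 24 ^ 7) ^ 2) ^ (2 / 9 : ℝ) * 24 ^ 3) •
    hodge0 (k := 3) (q := 4) rfl (θ.compContinuousLinearMap (Ring.inverse (metricOp θ)))

/-! ### Recovering the four-form from a pullback of the standard three-form -/

section Pullback

variable {A B : E7 →L[ℝ] E7}

theorem endDet_mul_endDet (hBA : B ∘L A = ContinuousLinearMap.id ℝ E7) :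
    endDet B * endDet A = 1 := by
  rw [← endDet_comp, hBA, endDet_id]

theorem adjoint_comp_adjoint (hBA : B ∘L A = ContinuousLinearMap.id ℝ E7) :
    ContinuousLinearMap.adjoint A ∘L ContinuousLinearMap.adjoint B =
      ContinuousLinearMap.id ℝ E7 := by
  rw [← ContinuousLinearMap.adjoint_comp, hBA]
  exact ContinuousLinearMap.ext fun u => ext_inner_right ℝ fun w => by
    simp [ContinuousLinearMap.adjoint_inner_left]

/-- The inverse of `metricOp` as a unit. -/
theorem exists_unit_metricOp (hAB : A ∘L B = ContinuousLinearMap.id ℝ E7)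
    (hBA : B ∘L A = ContinuousLinearMap.id ℝ E7) :
    ∃ U : (E7 →L[ℝ] E7)ˣ, (U : E7 →L[ℝ] E7) = metricOp (phi0.compContinuousLinearMap A) ∧
      ((U⁻¹ : (E7 →L[ℝ] E7)ˣ) : E7 →L[ℝ] E7) =
        (24 * endDet A)⁻¹ • (B ∘L ContinuousLinearMap.adjoint B) := by
  have hd : 24 * endDet A ≠ 0 :=
    mul_ne_zero (by norm_num) (right_ne_zero_of_mul_eq_one (endDet_mul_endDet hBA))
  have h1 := adjoint_comp_adjoint hBA
  have h2 := adjoint_comp_adjoint hAB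
  have e1 : ∀ u, A (B u) = u := fun u => congrArg (fun L : E7 →L[ℝ] E7 => L u) hAB
  have e2 : ∀ u, B (A u) = u := fun u => congrArg (fun L : E7 →L[ℝ] E7 => L u) hBA
  have e3 : ∀ u, ContinuousLinearMap.adjoint A (ContinuousLinearMap.adjoint B u) = u := fun u =>
    congrArg (fun L : E7 →L[ℝ] E7 => L u) h1
  have e4 : ∀ u, ContinuousLinearMap.adjoint B (ContinuousLinearMap.adjoint A u) = u := fun u =>
    congrArg (fun L : E7 →L[ℝ] E7 => L u) h2
  refine ⟨⟨metricOp (phi0.compContinuousLinearMap A),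
    (24 * endDet A)⁻¹ • (B ∘L ContinuousLinearMap.adjoint B), ?_, ?_⟩, rfl, rfl⟩
  · rw [metricOp_phi0_comp]
    refine ContinuousLinearMap.ext fun u => ?_
    change (24 * endDet A) • ContinuousLinearMap.adjoint A
      (A ((24 * endDet A)⁻¹ • B (ContinuousLinearMap.adjoint B u))) = u
    rw [map_smul, map_smul, e1, e3, smul_smul, mul_inv_cancel₀ hd, one_smul]
  · rw [metricOp_phi0_comp]
    refine ContinuousLinearMap.ext fun u => ?_
    change (24 * endDet A)⁻¹ • B (ContinuousLinearMap.adjoint B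
      ((24 * endDet A) • ContinuousLinearMap.adjoint A (A u))) = u
    rw [map_smul, map_smul, e4, e2, smul_smul, inv_mul_cancel₀ hd, one_smul]

/-- Let `δ = det A`, `B = A⁻¹`. The metric operator is `24 δ AᵀA`, with determinant `24⁷ δ⁹`.
Precomposing the pulled-back `φ` with its inverse gives `(24 δ)⁻³` times the pullback of `φ` by
`Bᵀ`, whose star is `δ⁻¹` times the pullback of `ψ` by `A`. The prefactor `24³ δ⁴` in `psiOf`
cancels the scalars. -/
theorem psiOf_phi0_comp (hAB : A ∘L B = ContinuousLinearMap.id ℝ E7)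
    (hBA : B ∘L A = ContinuousLinearMap.id ℝ E7) :
    psiOf (phi0.compContinuousLinearMap A) = psi0.compContinuousLinearMap A := by
  have hdet := endDet_mul_endDet hBA
  obtain ⟨U, hU, hU'⟩ := exists_unit_metricOp hAB hBA
  have e1 : ∀ u, A (B u) = u := fun u => congrArg (fun L : E7 →L[ℝ] E7 => L u) hAB
  have e2 : ∀ u, B (A u) = u := fun u => congrArg (fun L : E7 →L[ℝ] E7 => L u) hBA
  set δ := endDet A with hδ
  have hδ0 : δ ≠ 0 := right_ne_zero_of_mul_eq_one hdet
  have h1 : endDet (metricOp (phi0.compContinuousLinearMap A)) / 24 ^ 7 = δ ^ 9 := by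
    rw [metricOp_phi0_comp, endDet_smul, endDet_comp, endDet_adjoint, ← hδ]
    ring
  -- Squaring before the power `2/9` makes the formula valid for either sign of `δ`.
  have h2 : ((δ ^ 9) ^ 2) ^ (2 / 9 : ℝ) = δ ^ 4 := by
    have : (δ ^ 9) ^ 2 = (δ ^ 2) ^ (9 : ℝ) := by
      rw [← pow_mul, mul_comm, pow_mul]
      norm_cast
    rw [this, ← Real.rpow_mul (by positivity)]
    norm_num
    ring
  have h3 : (phi0.compContinuousLinearMap A).compContinuousLinearMap
      (Ring.inverse (metricOp (phi0.compContinuousLinearMap A))) =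
      ((24 * δ)⁻¹ ^ 3) • phi0.compContinuousLinearMap (ContinuousLinearMap.adjoint B) := by
    rw [← hU, Ring.inverse_unit, hU']
    ext v
    simp only [ContinuousAlternatingMap.compContinuousLinearMap_apply,
      ContinuousAlternatingMap.smul_apply]
    have := phi0.toMultilinearMap.map_smul_univ (fun _ => (24 * δ)⁻¹)
      (fun i => ContinuousLinearMap.adjoint B (v i))
    simp only [Finset.prod_const, Finset.card_univ, Fintype.card_fin] at this
    refine Eq.trans ?_ this
    change phi0 _ = phi0 _
    congr 1
    funext i
    simp [e1]
  have h4 : hodge0 (k := 3) (q := 4) rfl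
      (phi0.compContinuousLinearMap (ContinuousLinearMap.adjoint B)) =
      endDet B • psi0.compContinuousLinearMap A := by
    have := congrArg (fun θ => ContinuousAlternatingMap.compContinuousLinearMap θ A)
      (hodge0_comp_adjoint (k := 3) (q := 4) rfl B phi0)
    refine Eq.trans ?_ this
    ext v
    simp [Function.comp_def, e2]
  rw [psiOf, h1, h2, h3, hodge0_smul, h4, smul_smul, smul_smul]
  have h5 : δ ^ 4 * 24 ^ 3 * (24 * δ)⁻¹ ^ 3 * endDet B = 1 := by
    have : δ ^ 4 * 24 ^ 3 * (24 * δ)⁻¹ ^ 3 = δ := by field_simp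
    rw [this, mul_comm, hdet]
  rw [h5, one_smul]

end Pullback

/-! ### Differentiability of the four-form in the three-form -/

section Differentiability

/-- Makes the star, a linear map between spaces of forms, automatically continuous and hence
differentiable. -/
instance finiteDimensional_alternating (k : ℕ) :
    FiniteDimensional ℝ (E7 [⋀^Fin k]→L[ℝ] ℝ) := by
  let F : (E7 [⋀^Fin k]→L[ℝ] ℝ) →ₗ[ℝ] MultilinearMap ℝ (fun _ : Fin k => E7) ℝ :=
    { toFun := fun α => α.toMultilinearMap
      map_add' := fun _ _ => rfl
      map_smul' := fun _ _ => rfl }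
  refine Module.Finite.of_injective F fun α β h => ?_
  ext v
  exact congrArg (fun m : MultilinearMap ℝ (fun _ : Fin k => E7) ℝ => m v) h

/-- The Hodge star as a continuous linear map. -/
noncomputable def hodgeCLM {k q : ℕ} (h : k + q = 7) :
    (E7 [⋀^Fin k]→L[ℝ] ℝ) →L[ℝ] E7 [⋀^Fin q]→L[ℝ] ℝ :=
  LinearMap.toContinuousLinearMap
    { toFun := hodge0 h
      map_add' := hodge0_add h
      map_smul' := hodge0_smul h }

theorem differentiable_hodge0 {k q : ℕ} (h : k + q = 7) :
    Differentiable ℝ (hodge0 h : (E7 [⋀^Fin k]→L[ℝ] ℝ) → E7 [⋀^Fin q]→L[ℝ] ℝ) :=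
  (hodgeCLM h).differentiable

theorem differentiable_eval {k : ℕ} (v : Fin k → E7) :
    Differentiable ℝ fun θ : E7 [⋀^Fin k]→L[ℝ] ℝ => θ v :=
  (ContinuousAlternatingMap.apply ℝ E7 ℝ v).differentiable

theorem differentiable_formMetric (u v : E7) :
    Differentiable ℝ fun θ : E7 [⋀^Fin 3]→L[ℝ] ℝ => formMetric θ u v := by
  refine Differentiable.fun_sum fun P _ => ?_
  refine ((differentiable_eval _).mul (differentiable_eval _)).mul ?_
  exact (differentiable_eval (basisTuple P)).comp (differentiable_hodge0 _)

theorem differentiable_metricOp : Differentiable ℝ metricOp :=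
  Differentiable.fun_sum fun _ _ => Differentiable.fun_sum fun _ _ =>
    (differentiable_formMetric _ _).smul_const _

theorem differentiable_endDet : Differentiable ℝ endDet := by
  have h : ∀ i j, Differentiable ℝ fun A : E7 →L[ℝ] E7 => A (basisVec i) j := fun i j =>
    ((EuclideanSpace.proj j : E7 →L[ℝ] ℝ) ∘L
      ContinuousLinearMap.apply ℝ E7 (basisVec i)).differentiable
  have : endDet = fun A => ∑ σ : Equiv.Perm (Fin 7),
      ((Equiv.Perm.sign σ : ℤ) : ℝ) * ∏ i, A (basisVec (σ i)) i := by
    funext A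
    exact Matrix.det_apply' _
  rw [this]
  refine Differentiable.fun_sum fun σ _ => Differentiable.const_mul ?_ _
  exact fun A => (HasFDerivAt.finsetProd fun i _ => (h (σ i) i A).hasFDerivAt).differentiableAt

/-- The metric operator is polynomial in the form. At a pullback by an invertible `A` it is a unit,
so its inverse is differentiable there, and so is the real power of its nonzero squared determinant.
-/
theorem differentiableAt_psiOf {A B : E7 →L[ℝ] E7} (hAB : A ∘L B = ContinuousLinearMap.id ℝ E7)
    (hBA : B ∘L A = ContinuousLinearMap.id ℝ E7) :
    DifferentiableAt ℝ psiOf (phi0.compContinuousLinearMap A) := by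
  have hdet := endDet_mul_endDet hBA
  obtain ⟨U, hU, -⟩ := exists_unit_metricOp hAB hBA
  have hδ0 : endDet A ≠ 0 := right_ne_zero_of_mul_eq_one hdet
  have hne : endDet (metricOp (phi0.compContinuousLinearMap A)) ≠ 0 := by
    rw [metricOp_phi0_comp, endDet_smul, endDet_comp, endDet_adjoint]
    positivity
  have hm := differentiable_metricOp (phi0.compContinuousLinearMap A)
  have hc : DifferentiableAt ℝ (fun θ => endDet (metricOp θ)) (phi0.compContinuousLinearMap A) :=
    (differentiable_endDet _).comp (phi0.compContinuousLinearMap A) hm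
  have hd : DifferentiableAt ℝ (fun θ => (endDet (metricOp θ) / 24 ^ 7) ^ 2)
      (phi0.compContinuousLinearMap A) :=
    (hc.mul_const (24 ^ 7)⁻¹).pow 2
  have hi : DifferentiableAt ℝ (fun θ => Ring.inverse (metricOp θ))
      (phi0.compContinuousLinearMap A) :=
    DifferentiableAt.comp (g := Ring.inverse) (f := metricOp) (phi0.compContinuousLinearMap A)
      (differentiableAt_inverse (𝕜 := ℝ) (hU ▸ U.isUnit)) hm
  have hp := (hd.rpow_const (p := (2 / 9 : ℝ)) (Or.inl (by positivity))).mul_const (24 ^ 3)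
  refine hp.smul ((differentiable_hodge0 _ _).comp _ ?_)
  exact differentiableAt_id.continuousAlternatingMapCompContinuousLinearMap hi

end Differentiability

/-! ### Differentiability of `ψ` in charts -/

section Manifold

variable {Y : Type*} [TopologicalSpace Y] [ChartedSpace E7 Y]

/-- The adapted frame at a point, with the tangent space identified with the model space. -/
noncomputable def G2Structure.frameEquiv (G : G2Structure Y) (y : Y) : E7 ≃L[ℝ] E7 := G.frame y

/-- The adapted frame in a chart. -/
noncomputable def G2Structure.chartFrame (G : G2Structure Y) (e : OpenPartialHomeomorph Y E7)
    (z : E7) : E7 →L[ℝ] E7 :=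
  (G.frameEquiv (e.symm z) : E7 →L[ℝ] E7) ∘L symmDeriv e z

variable {G : G2Structure Y} {e : OpenPartialHomeomorph Y E7}

theorem G2Structure.val_form (y : Y) : Form.val G.form y =
    phi0.compContinuousLinearMap (G.frameEquiv y : E7 →L[ℝ] E7) := G.form_apply y

theorem G2Structure.val_psi (y : Y) : Form.val G.psi y =
    psi0.compContinuousLinearMap (G.frameEquiv y : E7 →L[ℝ] E7) := G.psi_apply y

theorem G2Structure.inChart_form (z : E7) :
    inChart e G.form z = phi0.compContinuousLinearMap (G.chartFrame e z) := by
  rw [inChart_apply, val_form]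
  rfl

theorem G2Structure.inChart_psi (z : E7) :
    inChart e G.psi z = psi0.compContinuousLinearMap (G.chartFrame e z) := by
  rw [inChart_apply, val_psi]
  generalize psi0 = θ
  rfl

variable [IsManifold (𝓡 7) ∞ Y]

theorem G2Structure.exists_inverse_chartFrame (he : e ∈ atlas E7 Y) {z : E7} (hz : z ∈ e.target) :
    ∃ B : E7 →L[ℝ] E7, G.chartFrame e z ∘L B = ContinuousLinearMap.id ℝ E7 ∧
      B ∘L G.chartFrame e z = ContinuousLinearMap.id ℝ E7 := by
  have h1 := chartDeriv_comp_symmDeriv he hz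
  have h2 := symmDeriv_comp_chartDeriv he (e.map_target hz)
  rw [e.right_inv hz] at h2
  rw [chartFrame]
  generalize G.frameEquiv (e.symm z) = u
  refine ⟨chartDeriv e (e.symm z) ∘L (u.symm : E7 →L[ℝ] E7), ?_, ?_⟩
  · refine ContinuousLinearMap.ext fun w => ?_
    have := congrArg (fun L : E7 →L[ℝ] E7 => L (u.symm w)) h2
    exact (congrArg u this).trans (u.apply_symm_apply w)
  · refine ContinuousLinearMap.ext fun w => ?_
    refine (congrArg (chartDeriv e (e.symm z)) (u.symm_apply_apply (symmDeriv e z w))).trans ?_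
    exact congrArg (fun L : E7 →L[ℝ] E7 => L w) h1

/-- The chosen frames need not vary continuously. `psiOf` eliminates them: throughout the chart `ψ`
is `psiOf` of the smooth form `φ`. -/
theorem G2Structure.differentiableAt_inChart_psi (he : e ∈ atlas E7 Y) {z : E7}
    (hz : z ∈ e.target) : DifferentiableAt ℝ (inChart e G.psi) z := by
  have hψ : inChart e G.psi =ᶠ[𝓝 z] psiOf ∘ inChart e G.form := by
    filter_upwards [e.open_target.mem_nhds hz] with w hw
    obtain ⟨B, hAB, hBA⟩ := G.exists_inverse_chartFrame he hw
    rw [Function.comp_apply, inChart_form, inChart_psi, psiOf_phi0_comp hAB hBA]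
  obtain ⟨B, hAB, hBA⟩ := G.exists_inverse_chartFrame he hz
  refine DifferentiableAt.congr_of_eventuallyEq ?_ hψ
  refine DifferentiableAt.comp z ?_ ((G.smooth.contDiffAt he hz).differentiableAt (by simp))
  rw [inChart_form]
  exact differentiableAt_psiOf hAB hBA

end Manifold

end HetG2

open HetG2 in
theorem mainTheorem4 {Y : Type*} [TopologicalSpace Y] [ChartedSpace E7 Y] [IsManifold (𝓡 7) ∞ Y]
    (G : G2Structure Y) (ϕ f : Y → ℝ) (H : Form Y 3)
    (hϕ : ContMDiff (𝓡 7) 𝓘(ℝ, ℝ) ∞ ϕ) (hf : ContMDiff (𝓡 7) 𝓘(ℝ, ℝ) ∞ f) (hH : IsSmooth H) :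
    (G.KillingSpinor ϕ H f ↔
      ∃ (Hp : Form Y 3) (τ₀ : Y → ℝ) (τ₁ : Form Y 1) (τ₂ : Form Y 2) (τ₃ : Form Y 3),
        G.IsFluxDecomposition H f Hp ∧ G.IsTorsion τ₀ τ₁ τ₂ τ₃ ∧
        (∀ y, τ₀ y = -(15 / 14) * f y) ∧
        τ₁ = (1 / 2 : ℝ) • dFun ϕ ∧
        τ₂ = 0 ∧
        τ₃ = -Hp - (1 / 2 : ℝ) • G.contract (dFun ϕ) G.psi ∧
        G.hodge (k := 3) (q := 4) rfl τ₃ =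
          -G.hodge (k := 3) (q := 4) rfl Hp
            + (1 / 2 : ℝ) • (fwedge (dFun ϕ) G.form : Form Y 4)) ∧
    (G.KillingSpinor ϕ H f → Bianchi H f → G.FluxEOM ϕ H) :=
  ⟨G.killingSpinor_iff ϕ f H, fun hK hB => hK.fluxEOM hϕ
    (fun x => G.differentiableAt_inChart_psi (chart_mem_atlas E7 x) (mem_chart_target E7 x)) hB⟩
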